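/- For $x\in\mathbb C$ and $n\in\mathbb N$ let $(x)_n=x(x+1)\cdots(x+n-1)$, and for complex $a$ let $(x)_a=\Gamma(x+a)/\Gamma(x)$. For complex $a$ that is not a negative integer put $$f(a)=\sum_{n=0}^{\infty}\frac{(-1)^n}{2^{3n}}\,\frac{(a+\frac12)_n^3}{(a+1)_n^3}\,[6(n+a)+1].$$ This series converges for all such $a$, and the following hold. (i) For every such $a$ for which the series on the right converges (in particular, for all $a$ with $\operatorname{Re} a>0$), $$f(a)=4a\sum_{n=0}^{\infty}\frac{(\frac a2+\frac14)_n(\frac a2+\frac34)_n}{(a+1)_n^2}.$$ (ii) For every such $a$ with $\cos\pi a\neq 0$, the series on the right converges and $$f(a)=\frac{2\sqrt2}{\pi}\cdot\frac{8^a}{\cos\pi a}\cdot\frac{(1)_a^3}{(\frac12)_a^3}+\frac{16a^2}{2a-1}\sum_{n=0}^{\infty}\frac1{2^n}\cdot\frac{(a+\frac12)_n^2}{(a+1)_n(\frac32-a)_n}.$$ (iii) $f(\frac12)=4G$, where $G=\sum_{n\ge0}(-1)^n/(2n+1)^2$ is Catalan's constant; $f$ is analytic at $0$, and $$f(0)=\frac{2\sqrt2}{\pi},\qquad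 f'(0)=\frac{18\sqrt2}{\pi}\ln 2,\qquad f''(0)=\frac{2\sqrt2}{\pi}\left(81\ln^2 2-4\pi^2\right).$$ -/

import Mathlib

namespace ExtendedRamanujan

/-- The rising factorial `(x)_n = x (x + 1) ⋯ (x + n - 1)` with a natural number `n`. -/
noncomputable def poch (x : ℂ) (n : ℕ) : ℂ := ∏ j ∈ Finset.range n, (x + (j : ℂ))

/-- The rising factorial `(x)_a = Γ(x + a) / Γ(x)` with a complex index `a`. -/
noncomputable def cpoch (x a : ℂ) : ℂ := Complex.Gamma (x + a) / Complex.Gamma x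

/-- The parameters `a` for which no `(a + 1)_n` vanishes: `a` is not a negative integer. -/
def Admissible (a : ℂ) : Prop := ∀ m : ℕ, a ≠ -((m : ℂ) + 1)

/-- The `n`-th term of the series that defines `f(a)`. -/
noncomputable def fTerm (a : ℂ) (n : ℕ) : ℂ :=
  (-1) ^ n / 2 ^ (3 * n) * (poch (a + 1 / 2) n ^ 3 / poch (a + 1) n ^ 3)
    * (6 * ((n : ℂ) + a) + 1)

/-- The extended Ramanujan-type series. -/
noncomputable def f (a : ℂ) : ℂ := ∑' n : ℕ, fTerm a n

/-- The `n`-th term of the series in the first identity. -/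
noncomputable def firstTerm (a : ℂ) (n : ℕ) : ℂ :=
  poch (a / 2 + 1 / 4) n * poch (a / 2 + 3 / 4) n / poch (a + 1) n ^ 2

/-- The `n`-th term of the series in the second identity. -/
noncomputable def secondTerm (a : ℂ) (n : ℕ) : ℂ :=
  1 / 2 ^ n * (poch (a + 1 / 2) n ^ 2 / (poch (a + 1) n * poch (3 / 2 - a) n))

/-- Catalan's constant `G = 1 - 1/3² + 1/5² - ⋯`. -/
noncomputable def catalanConstant : ℝ := ∑' n : ℕ, (-1) ^ n / (2 * (n : ℝ) + 1) ^ 2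

end ExtendedRamanujan

namespace ExtendedRamanujan

open Filter Topology

/-! ### Rising factorials -/

/-! Everything rests on one first-order recurrence. Peeling off the first term gives `f a = 6 * a +
1 + recFactor a * f (a + 1)` (`f_recurrence`). The first right-hand side and the series part
`second` of the second one satisfy the same recurrence: a WZ-type certificate turns the claim into a
telescoping sum whose boundary term at `k = 0` is `6 * a + 1` (`firstTerm_telescope`,
`secondTerm_telescope`). Differences of solutions solve the homogeneous equation, and the two
identities differ in how such a solution is identified.

For (i), the difference `h` satisfies `h a = fCoeff a n * h (a + n)`. The coefficient decays
geometrically, while both sides grow at most linearly far to the right, so `h = 0` (`f_eq_first`).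

For (ii), the difference is not zero. Multiplication by `gammaFactor` makes `f - second`
antiperiodic under `a ↦ a + 1`. In a strip slightly wider than `0 ≤ re a ≤ 1` its only possible
singularity is a simple pole at `1 / 2`, which a multiple of `1 / cos (π a)`, also antiperiodic,
removes. The result `stripDiff` is holomorphic and tends to zero along the imaginary axis. By
Phragmén–Lindelöf and antiperiodicity its modulus, if not identically zero, has a maximum over the
open strip on that axis; it is then constant, and an antiperiodic constant is zero
(`stripDiff_eq_zero`). The multiple of `1 / cos (π a)` is read off from the series at `a = 1 / 2`,
and the recurrence carries the identity to all admissible `a` (`f_eq_second`).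

For (iii), the first identity at `1 / 2` gives a series for Catalan's constant, obtained by
evaluating `∫ x / sin x` over `[0, π / 2]` in two ways (`hasSum_oddWallis_div`). At `0`, `second`
has a double zero, and Legendre duplication writes the explicit term as an exponential times Gamma
values and `1 / cos (π a)`, so Taylor coefficients up to order two can be compared (`hasJet_f`). -/

@[simp] theorem poch_zero (x : ℂ) : poch x 0 = 1 := by simp [poch]

theorem poch_succ (x : ℂ) (n : ℕ) : poch x (n + 1) = poch x n * (x + n) := by
  simp [poch, Finset.prod_range_succ]

theorem poch_succ' (x : ℂ) (n : ℕ) : poch x (n + 1) = x * poch (x + 1) n := by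
  rw [poch, Finset.prod_range_succ']
  simp only [poch, Nat.cast_zero, add_zero, Nat.cast_add, Nat.cast_one]
  rw [mul_comm]
  congr 1
  exact Finset.prod_congr rfl fun j _ => by ring

theorem mul_poch_add_one (x : ℂ) (n : ℕ) : x * poch (x + 1) n = poch x n * (x + n) := by
  rw [← poch_succ', poch_succ]

theorem poch_ne_zero {x : ℂ} (hx : ∀ j : ℕ, x + j ≠ 0) (n : ℕ) : poch x n ≠ 0 :=
  Finset.prod_ne_zero_iff.2 fun j _ => hx j

theorem Admissible.add_ne_zero {a : ℂ} (ha : Admissible a) (j : ℕ) : a + 1 + j ≠ 0 := by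
  intro h
  exact ha j (by linear_combination h)

theorem Admissible.one_ne_zero {a : ℂ} (ha : Admissible a) : a + 1 ≠ 0 := by
  simpa using ha.add_ne_zero 0

theorem Admissible.add_one {a : ℂ} (ha : Admissible a) : Admissible (a + 1) := by
  intro m h
  exact ha (m + 1) (by push_cast; linear_combination h)

theorem Admissible.add_nat {a : ℂ} (ha : Admissible a) (n : ℕ) : Admissible (a + n) := by
  intro m h
  exact ha (m + n) (by push_cast; linear_combination h)

theorem admissible_of_re {a : ℂ} (ha : -1 < a.re) : Admissible a := by
  rintro m rfl
  simp at ha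
  linarith [m.cast_nonneg (α := ℝ)]

/-! ### Summability by ratios -/

theorem tendsto_add_natCast_inv (y : ℂ) : Tendsto (fun n : ℕ => (y + n)⁻¹) atTop (𝓝 0) := by
  refine tendsto_inv₀_cobounded.comp ?_
  exact (tendsto_const_add_cobounded y).comp tendsto_natCast_atTop_cobounded

theorem tendsto_add_div_add_natCast (x y : ℂ) :
    Tendsto (fun n : ℕ => (x + n) / (y + n)) atTop (𝓝 1) := by
  have h : Tendsto (fun n : ℕ => 1 + (x - y) * (y + n)⁻¹) atTop (𝓝 (1 + (x - y) * 0)) :=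
    ((tendsto_add_natCast_inv y).const_mul _).const_add _
  rw [mul_zero, add_zero] at h
  refine h.congr' ?_
  have h0 : ∀ᶠ n : ℕ in atTop, y + n ≠ 0 := by
    have := (tendsto_const_add_cobounded y).comp (tendsto_natCast_atTop_cobounded (α := ℂ))
    exact this.eventually (Bornology.eventually_ne_cobounded 0)
  filter_upwards [h0] with n hn
  field_simp
  ring

/-- A polynomial weight does not change the limit of the ratios. The weight is there so that the
same fact also sends polynomial multiples of the terms, such as telescoping boundary terms, to zero.
-/
theorem summable_natCast_pow_mul_of_ratio {v r : ℕ → ℂ} {l : ℂ} (p : ℕ)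
    (hv : ∀ n, v (n + 1) = v n * r n) (hr : Tendsto r atTop (𝓝 l)) (hl : ‖l‖ < 1) :
    Summable fun n : ℕ => (1 + (n : ℂ)) ^ p * v n := by
  obtain ⟨ρ, h1, h2⟩ := exists_between hl
  have h3 : Tendsto (fun n : ℕ => ‖((2 + (n : ℂ)) / (1 + n)) ^ p * r n‖) atTop
      (𝓝 ‖1 ^ p * l‖) := (((tendsto_add_div_add_natCast 2 1).pow p).mul hr).norm
  rw [one_pow, one_mul] at h3
  refine summable_of_ratio_norm_eventually_le h2 ?_
  filter_upwards [h3.eventually_lt_const h1] with n hn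
  have h0 : (1 + (n : ℂ)) ≠ 0 := by
    have : ((n + 1 : ℕ) : ℂ) ≠ 0 := Nat.cast_ne_zero.2 n.succ_ne_zero
    push_cast at this
    rwa [add_comm]
  have : (1 + ((n + 1 : ℕ) : ℂ)) ^ p * v (n + 1)
      = ((2 + (n : ℂ)) / (1 + n)) ^ p * r n * ((1 + (n : ℂ)) ^ p * v n) := by
    rw [hv, div_pow]
    field_simp
    push_cast
    ring
  rw [this, norm_mul]
  exact mul_le_mul_of_nonneg_right hn.le (norm_nonneg _)

/-! ### The series `f` and its recurrence -/

/-- The factor in the first-order recurrence that `f` satisfies. -/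
noncomputable def recFactor (a : ℂ) : ℂ := -(1 / 8) * ((a + 1 / 2) / (a + 1)) ^ 3

/-- The hypergeometric factor of `fTerm`. -/
noncomputable def fCoeff (a : ℂ) (n : ℕ) : ℂ :=
  (-1) ^ n / 2 ^ (3 * n) * (poch (a + 1 / 2) n ^ 3 / poch (a + 1) n ^ 3)

theorem fTerm_eq (a : ℂ) (n : ℕ) : fTerm a n = fCoeff a n * (6 * (n + a) + 1) := rfl

theorem fCoeff_eq (a : ℂ) (n : ℕ) :
    fCoeff a n = (-(1 / 8)) ^ n * (poch (a + 1 / 2) n / poch (a + 1) n) ^ 3 := by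
  rw [fCoeff, pow_mul, ← div_pow, ← div_pow]
  norm_num

/-- This persists at negative integers: quotients by zero are zero and still multiply factor by
factor. -/
theorem fCoeff_succ (a : ℂ) (n : ℕ) : fCoeff a (n + 1) = fCoeff a n * recFactor (a + n) := by
  rw [fCoeff_eq, fCoeff_eq, recFactor, poch_succ, poch_succ, mul_div_mul_comm, pow_succ,
    add_right_comm a (1 / 2), add_right_comm a 1]
  ring

theorem fCoeff_succ' (a : ℂ) (n : ℕ) : fCoeff a (n + 1) = recFactor a * fCoeff (a + 1) n := by
  rw [fCoeff_eq, fCoeff_eq, recFactor, poch_succ', poch_succ', mul_div_mul_comm, pow_succ,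
    add_right_comm a (1 / 2)]
  ring

theorem tendsto_recFactor (a : ℂ) :
    Tendsto (fun n : ℕ => recFactor (a + n)) atTop (𝓝 (-(1 / 8))) := by
  have h := ((tendsto_add_div_add_natCast (a + 1 / 2) (a + 1)).pow 3).const_mul (-(1 / 8) : ℂ)
  simpa [recFactor, add_right_comm] using h

theorem summable_natCast_pow_mul_fCoeff (a : ℂ) (p : ℕ) :
    Summable fun n : ℕ => (1 + (n : ℂ)) ^ p * fCoeff a n :=
  summable_natCast_pow_mul_of_ratio p (fCoeff_succ a) (tendsto_recFactor a) (by norm_num)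

theorem summable_fTerm (a : ℂ) : Summable (fTerm a) := by
  refine (((summable_natCast_pow_mul_fCoeff a 1).mul_left 6).add
    ((summable_natCast_pow_mul_fCoeff a 0).mul_left (6 * a - 5))).congr fun n => ?_
  rw [fTerm_eq]
  ring

/-- The linear factor depends only on `n + a`, so dropping the first term amounts to replacing `a`
by `a + 1` up to the factor `recFactor a`. -/
theorem f_recurrence (a : ℂ) : f a = 6 * a + 1 + recFactor a * f (a + 1) := by
  rw [f, (summable_fTerm a).tsum_eq_zero_add, f, ← tsum_mul_left]
  congr 1
  · simp [fTerm]
  · refine tsum_congr fun n => ?_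
    rw [fTerm_eq, fTerm_eq, fCoeff_succ']
    push_cast
    ring

/-- A solution of the homogeneous recurrence, iterated. -/
theorem eq_fCoeff_mul_of_recurrence {h : ℂ → ℂ} {a : ℂ}
    (hh : ∀ n : ℕ, h (a + n) = recFactor (a + n) * h (a + n + 1)) (n : ℕ) :
    h a = fCoeff a n * h (a + n) := by
  induction n with
  | zero => simp [fCoeff]
  | succ n ih =>
    rw [ih, hh, fCoeff_succ]
    push_cast
    ring_nf

/-- A telescoping relation between two series, summed. -/
theorem tsum_telescope {F₁ F₀ G : ℕ → ℂ} {c : ℂ} (h₁ : Summable F₁) (h₀ : Summable F₀)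
    (hG : Tendsto G atTop (𝓝 0)) (h : ∀ k, c * F₁ k - F₀ k = G (k + 1) - G k) :
    ∑' k, F₀ k = G 0 + c * ∑' k, F₁ k := by
  have hs : HasSum (fun k => c * F₁ k - F₀ k) (c * ∑' k, F₁ k - ∑' k, F₀ k) :=
    (h₁.hasSum.mul_left c).sub h₀.hasSum
  have ht := hs.tendsto_sum_nat
  simp only [h, Finset.sum_range_sub] at ht
  have := tendsto_nhds_unique ht (hG.sub_const (G 0))
  linear_combination -this

/-! ### Growth of `f` -/

theorem norm_poch_le_of_le {x y : ℂ} {n : ℕ} (h : ∀ j : ℕ, ‖x + j‖ ≤ ‖y + j‖) :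
    ‖poch x n‖ ≤ ‖poch y n‖ := by
  rw [poch, poch, norm_prod, norm_prod]
  exact Finset.prod_le_prod (fun _ _ => norm_nonneg _) fun j _ => h j

theorem norm_le_norm_of_re_im {z w : ℂ} (hre : z.re ^ 2 ≤ w.re ^ 2) (him : z.im ^ 2 ≤ w.im ^ 2) :
    ‖z‖ ≤ ‖w‖ := by
  refine le_of_sq_le_sq ?_ (norm_nonneg _)
  rw [Complex.sq_norm, Complex.sq_norm, Complex.normSq_apply, Complex.normSq_apply]
  linarith

/-- The bound `-3/4` is the midpoint of `-1` and `-1/2`: to its right, `a` is nearer to `-1/2` than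
to `-1`. -/
theorem norm_half_add_le_norm_one_add {a : ℂ} (ha : -(3 / 4) ≤ a.re) (j : ℕ) :
    ‖a + 1 / 2 + j‖ ≤ ‖a + 1 + j‖ := by
  have hj : (0 : ℝ) ≤ j := j.cast_nonneg
  refine norm_le_norm_of_re_im ?_ ?_
  · simp
    nlinarith
  · simp

theorem norm_poch_half_div_le_one {a : ℂ} (ha : -(3 / 4) ≤ a.re) (n : ℕ) :
    ‖poch (a + 1 / 2) n / poch (a + 1) n‖ ≤ 1 := by
  rw [norm_div]
  exact div_le_one_of_le₀ (norm_poch_le_of_le (norm_half_add_le_norm_one_add ha)) (norm_nonneg _)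

theorem norm_fTerm_le {a : ℂ} (ha : -(3 / 4) ≤ a.re) (n : ℕ) :
    ‖fTerm a n‖ ≤ (1 / 8) ^ n * (6 * n + 7) * (1 + ‖a‖) := by
  rw [fTerm_eq, fCoeff_eq, norm_mul, norm_mul, norm_pow, norm_pow, mul_assoc _ _ (1 + ‖a‖)]
  have h1 : ‖poch (a + 1 / 2) n / poch (a + 1) n‖ ^ 3 ≤ 1 :=
    pow_le_one₀ (norm_nonneg _) (norm_poch_half_div_le_one ha n)
  have h2 : ‖6 * ((n : ℂ) + a) + 1‖ ≤ (6 * n + 7) * (1 + ‖a‖) := by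
    calc ‖6 * ((n : ℂ) + a) + 1‖ ≤ 6 * (n + ‖a‖) + 1 := by
          refine (norm_add_le _ _).trans ?_
          rw [norm_mul]
          have := norm_add_le (n : ℂ) a
          simp at this ⊢
          linarith
      _ ≤ _ := by nlinarith [norm_nonneg a, mul_nonneg (n.cast_nonneg (α := ℝ)) (norm_nonneg a)]
  have h3 : ‖(-(1 / 8) : ℂ)‖ = 1 / 8 := by norm_num
  rw [h3]
  calc _ ≤ (1 / 8) ^ n * 1 * ((6 * n + 7) * (1 + ‖a‖)) := by gcongr
    _ = _ := by ring

theorem summable_fTerm_bound : Summable fun n : ℕ => (1 / 8 : ℝ) ^ n * (6 * n + 7) := by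
  have h1 := (summable_pow_mul_geometric_of_norm_lt_one (R := ℝ) 1 (r := 1 / 8)
    (by norm_num)).mul_left 6
  have h2 := (summable_geometric_of_lt_one (r := (1 / 8 : ℝ)) (by norm_num) (by norm_num)).mul_left 7
  refine (h1.add h2).congr fun n => ?_
  ring

theorem exists_norm_f_le : ∃ C : ℝ, 0 ≤ C ∧ ∀ a : ℂ, -(3 / 4) ≤ a.re → ‖f a‖ ≤ C * (1 + ‖a‖) := by
  refine ⟨∑' n : ℕ, (1 / 8 : ℝ) ^ n * (6 * n + 7), tsum_nonneg fun n => by positivity, ?_⟩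
  intro a ha
  rw [← tsum_mul_right]
  exact tsum_of_norm_bounded (summable_fTerm_bound.mul_right _).hasSum (norm_fTerm_le ha)

/-! ### The first identity -/

theorem firstTerm_succ (a : ℂ) (k : ℕ) : firstTerm a (k + 1) =
    firstTerm a k * ((a / 2 + 1 / 4 + k) * (a / 2 + 3 / 4 + k) / (a + 1 + k) ^ 2) := by
  rw [firstTerm, firstTerm, poch_succ, poch_succ, poch_succ, div_mul_div_comm]
  ring

/-- Under `a ↦ a + 1` the two numerator parameters exchange roles, and one of them moves up by one.
The factor `a / 2 + 1 / 4` stays on the left because it vanishes at `a = -1/2`. -/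
theorem mul_firstTerm_add_one {a : ℂ} (ha : Admissible a) (k : ℕ) :
    (a / 2 + 1 / 4) * firstTerm (a + 1) k =
      firstTerm a k * ((a / 2 + 1 / 4 + k) * ((a + 1) / (a + 1 + k)) ^ 2) := by
  have h1 := mul_poch_add_one (a / 2 + 1 / 4) k
  have h2 := mul_poch_add_one (a + 1) k
  have h3 := ha.one_ne_zero
  have h4 := ha.add_ne_zero k
  have h5 : poch (a + 1) k ≠ 0 := poch_ne_zero ha.add_ne_zero k
  have h6 : poch (a + 1 + 1) k = poch (a + 1) k * (a + 1 + k) / (a + 1) := by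
    rw [← h2]
    field_simp
  rw [firstTerm, firstTerm, h6]
  rw [show (a + 1) / 2 + 1 / 4 = a / 2 + 3 / 4 by ring,
    show (a + 1) / 2 + 3 / 4 = a / 2 + 1 / 4 + 1 by ring]
  rw [mul_div_assoc', mul_left_comm, h1]
  generalize poch (a / 2 + 3 / 4) k = q, poch (a / 2 + 1 / 4) k = p
  field_simp

/-- The WZ certificate is `6 * a + 1 + 4 * k`; its value at `k = 0` is the inhomogeneity of the
recurrence of `f`. -/
theorem firstTerm_telescope {a : ℂ} (ha : Admissible a) (k : ℕ) :
    recFactor a * (4 * (a + 1) * firstTerm (a + 1) k) - 4 * a * firstTerm a k =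
      firstTerm a (k + 1) * (6 * a + 1 + 4 * (k + 1 : ℕ)) - firstTerm a k * (6 * a + 1 + 4 * k) := by
  have h3 := ha.one_ne_zero
  have h4 := ha.add_ne_zero k
  -- One of the three factors `a + 1/2` is spent as `2 * (a / 2 + 1 / 4)`, so nothing that may
  -- vanish is divided out.
  have h : recFactor a * (4 * (a + 1) * firstTerm (a + 1) k) =
      -((a + 1 / 2) / (a + 1)) ^ 2 * ((a / 2 + 1 / 4) * firstTerm (a + 1) k) := by
    rw [recFactor]
    field_simp
    ring
  rw [h, mul_firstTerm_add_one ha, firstTerm_succ]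
  push_cast
  field_simp
  ring

theorem norm_poch_succ_eq {s : ℂ} (hs : 0 < s.re) {n : ℕ} (hn : 0 < n) :
    ‖poch s (n + 1)‖ = (n : ℝ) ^ s.re * n.factorial / ‖Complex.GammaSeq s n‖ := by
  have h0 : poch s (n + 1) ≠ 0 := poch_ne_zero (fun j h => by
    have := congrArg Complex.re h
    simp at this
    linarith [j.cast_nonneg (α := ℝ)]) _
  have h1 : Complex.GammaSeq s n = (n : ℂ) ^ s * n.factorial / poch s (n + 1) := rfl
  have h2 : (0 : ℝ) < (n : ℝ) ^ s.re := Real.rpow_pos_of_pos (by exact_mod_cast hn) _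
  have h3 : (n.factorial : ℝ) ≠ 0 := by positivity
  rw [h1, norm_div, norm_mul, Complex.norm_natCast, Complex.norm_natCast_cpow_of_pos hn]
  have : ‖poch s (n + 1)‖ ≠ 0 := norm_ne_zero_iff.2 h0
  field_simp

/-- Euler's limit for Gamma gives the size of each rising factorial. The numerator parameters add up
to `a + 1`, so the powers of `n` combine to `n ^ (-(re a + 1))`. -/
theorem summable_firstTerm {a : ℂ} (ha : 0 < a.re) : Summable (firstTerm a) := by
  rw [← summable_nat_add_iff 1]
  set x := a / 2 + 1 / 4
  set y := a / 2 + 3 / 4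
  have hx : 0 < x.re := by simp [x]; linarith
  have hy : 0 < y.re := by simp [y]; linarith
  have hz : 0 < (a + 1).re := by simp; linarith
  have hne : ∀ {s : ℂ}, 0 < s.re → ‖Complex.Gamma s‖ ≠ 0 := fun hs =>
    norm_ne_zero_iff.2 (Complex.Gamma_ne_zero_of_re_pos hs)
  have hlim := (((Complex.GammaSeq_tendsto_Gamma (a + 1)).norm.pow 2).div
    ((Complex.GammaSeq_tendsto_Gamma x).norm.mul (Complex.GammaSeq_tendsto_Gamma y).norm)
    (mul_ne_zero (hne hx) (hne hy))).eventually_le_const (lt_add_one _)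
  set C := ‖Complex.Gamma (a + 1)‖ ^ 2 / (‖Complex.Gamma x‖ * ‖Complex.Gamma y‖) + 1
  have hsum : Summable fun n : ℕ => C * (1 / (n : ℝ) ^ (a.re + 1)) :=
    (Real.summable_one_div_nat_rpow.2 (by linarith)).mul_left C
  refine Summable.of_norm_bounded_eventually_nat hsum ?_
  filter_upwards [hlim, eventually_gt_atTop 0] with n hn hn0
  have hn' : (0 : ℝ) < n := by exact_mod_cast hn0
  have hp : ((n : ℝ) ^ (a.re + 1)) ^ 2 = (n : ℝ) ^ x.re * (n : ℝ) ^ y.re * (n : ℝ) ^ (a.re + 1) := by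
    rw [← Real.rpow_natCast, ← Real.rpow_mul hn'.le, ← Real.rpow_add hn', ← Real.rpow_add hn']
    congr 1
    simp [x, y]
    ring
  rw [firstTerm, norm_div, norm_mul, norm_pow, norm_poch_succ_eq hx hn0, norm_poch_succ_eq hy hn0,
    norm_poch_succ_eq hz hn0]
  have e : (a + 1).re = a.re + 1 := by simp
  have hp' : (n : ℝ) ^ x.re * (n : ℝ) ^ y.re = (n : ℝ) ^ (a.re + 1) := by
    have h0 : (n : ℝ) ^ (a.re + 1) ≠ 0 := (Real.rpow_pos_of_pos hn' _).ne'
    rw [pow_two] at hp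
    exact (mul_right_cancel₀ h0 hp).symm
  rw [e]
  have h0 : (n : ℝ) ^ (a.re + 1) ≠ 0 := (Real.rpow_pos_of_pos hn' _).ne'
  have h1 : (n.factorial : ℝ) ≠ 0 := by positivity
  refine le_trans (le_of_eq ?_) (mul_le_mul_of_nonneg_right hn (by positivity))
  simp only [Pi.div_apply]
  rw [div_mul_div_comm, mul_mul_mul_comm, hp', div_pow, mul_pow, div_div_div_eq]
  generalize (n : ℝ) ^ (a.re + 1) = r at *
  generalize ‖x.GammaSeq n‖ * ‖y.GammaSeq n‖ = g
  field_simp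

theorem summable_firstTerm_add_one {a : ℂ} (ha : Admissible a) (hs : Summable (firstTerm a)) :
    Summable (firstTerm (a + 1)) := by
  by_cases h0 : a / 2 + 1 / 4 = 0
  -- At `a = -1/2` the shift relation reads `0 = 0`, but then `a + 1 = 1/2` has positive real part.
  · refine summable_firstTerm ?_
    rw [show a = -1 / 2 by linear_combination 2 * h0]
    norm_num
  have hl : Tendsto (fun k : ℕ => (a / 2 + 1 / 4 + k) / (a + 1 + k) * (a + 1) ^ 2 * (a + 1 + k)⁻¹ /
      (a / 2 + 1 / 4)) atTop (𝓝 0) := by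
    have := (((tendsto_add_div_add_natCast (a / 2 + 1 / 4) (a + 1)).mul_const ((a + 1) ^ 2)).mul
      (tendsto_add_natCast_inv (a + 1))).div_const (a / 2 + 1 / 4)
    simpa using this
  refine Summable.of_norm_bounded_eventually_nat hs.norm ?_
  have h1 := hl.norm
  rw [norm_zero] at h1
  filter_upwards [h1.eventually_le_const one_pos] with k hk
  have h2 : firstTerm (a + 1) k = firstTerm a k * ((a / 2 + 1 / 4 + k) / (a + 1 + k) * (a + 1) ^ 2 *
      (a + 1 + k)⁻¹ / (a / 2 + 1 / 4)) := by
    rw [mul_div_assoc', eq_div_iff h0, mul_comm _ (a / 2 + 1 / 4), mul_firstTerm_add_one ha k]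
    ring
  rw [h2, norm_mul]
  exact mul_le_of_le_one_right (norm_nonneg _) hk

/-- The telescoping relation makes the sequence converge. A nonzero limit would bound `‖firstTerm a
k‖` below by a multiple of `1 / (k + 1)`, against summability. This is how mere convergence of the
series suffices for the first identity. -/
theorem tendsto_firstTerm_mul {a : ℂ} (ha : Admissible a) (hs : Summable (firstTerm a)) :
    Tendsto (fun k : ℕ => firstTerm a k * (6 * a + 1 + 4 * k)) atTop (𝓝 0) := by
  set G : ℕ → ℂ := fun k => firstTerm a k * (6 * a + 1 + 4 * k) with hG
  have h1 := ((((summable_firstTerm_add_one ha hs).mul_left (4 * (a + 1))).mul_left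
    (recFactor a)).sub (hs.mul_left (4 * a))).hasSum.tendsto_sum_nat
  simp only [firstTerm_telescope ha] at h1
  have h2 : ∀ n, ∑ k ∈ Finset.range n, (G (k + 1) - G k) = G n - G 0 := Finset.sum_range_sub G
  simp only [hG] at h2
  simp only [h2] at h1
  obtain ⟨L, hL⟩ : ∃ L, Tendsto G atTop (𝓝 L) := ⟨_, by simpa [hG] using h1.add_const (G 0)⟩
  rcases eq_or_ne L 0 with rfl | hL0
  · exact hL
  have hLpos : 0 < ‖L‖ / 2 := half_pos (norm_pos_iff.2 hL0)
  suffices h : Summable fun k : ℕ => 1 / ((k + 1 : ℕ) : ℝ) from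
    absurd ((summable_nat_add_iff (f := fun k : ℕ => 1 / (k : ℝ)) 1).1 h)
      Real.not_summable_one_div_natCast
  refine Summable.of_norm_bounded_eventually_nat (hs.norm.mul_left ((6 * ‖a‖ + 5) / (‖L‖ / 2))) ?_
  filter_upwards [hL.norm.eventually_const_le (half_lt_self (norm_pos_iff.2 hL0))] with k hk
  have h3 : ‖6 * a + 1 + 4 * (k : ℂ)‖ ≤ (6 * ‖a‖ + 5) * (k + 1) := by
    have h4 : ‖6 * a + 1 + 4 * (k : ℂ)‖ ≤ 6 * ‖a‖ + 1 + 4 * k := by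
      refine (norm_add₃_le).trans ?_
      simp
    nlinarith [norm_nonneg a, mul_nonneg (norm_nonneg a) (k.cast_nonneg (α := ℝ))]
  have hk' : ‖L‖ / 2 ≤ ‖firstTerm a k‖ * ((6 * ‖a‖ + 5) * (k + 1)) := by
    refine hk.trans ?_
    rw [hG, norm_mul]
    gcongr
  rw [Real.norm_of_nonneg (by positivity), div_mul_eq_mul_div, div_le_div_iff₀ (by positivity) hLpos]
  push_cast
  linarith

theorem first_recurrence {a : ℂ} (ha : Admissible a) (hs : Summable (firstTerm a)) :
    4 * a * ∑' k, firstTerm a k =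
      6 * a + 1 + recFactor a * (4 * (a + 1) * ∑' k, firstTerm (a + 1) k) := by
  have := tsum_telescope ((summable_firstTerm_add_one ha hs).mul_left (4 * (a + 1)))
    (hs.mul_left (4 * a)) (tendsto_firstTerm_mul ha hs) (firstTerm_telescope ha)
  rw [tsum_mul_left, tsum_mul_left] at this
  rw [this]
  simp [firstTerm]

/-- The factors `(j + 2) / (j + 3)` telescope to `2 / (k + 2)`. Two such products give a summable
bound for `firstTerm b`, uniform in `re b ≥ 2`. -/
theorem norm_half_add_le {b : ℂ} (hb : 2 ≤ b.re) {s : ℝ} (hs0 : 0 ≤ s) (hs : s ≤ 3 / 4) (j : ℕ) :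
    ‖b / 2 + s + j‖ ≤ ‖b + 1 + j‖ * ((j + 2) / (j + 3)) := by
  have hj : (0 : ℝ) ≤ j := j.cast_nonneg
  have : ‖b + 1 + j‖ * (((j : ℝ) + 2) / (j + 3)) = ‖(b + 1 + j) * (((j + 2) / (j + 3) : ℝ) : ℂ)‖ := by
    rw [norm_mul, Complex.norm_real, Real.norm_of_nonneg (by positivity)]
  rw [this]
  have h1 : (1 / 2 : ℝ) ≤ (j + 2) / (j + 3) := by
    rw [div_le_div_iff₀ (by norm_num) (by positivity)]
    linarith
  refine norm_le_norm_of_re_im ?_ ?_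
  · rw [Complex.re_mul_ofReal]
    simp
    refine pow_le_pow_left₀ (by positivity) ?_ 2
    rw [mul_div_assoc', le_div_iff₀ (by positivity)]
    nlinarith
  · rw [Complex.im_mul_ofReal]
    simp
    rw [mul_pow, div_pow]
    nlinarith [sq_nonneg b.im, mul_le_mul h1 h1 (by norm_num) (by positivity)]

theorem norm_poch_half_le {b : ℂ} (hb : 2 ≤ b.re) {s : ℝ} (hs0 : 0 ≤ s) (hs : s ≤ 3 / 4) (k : ℕ) :
    ‖poch (b / 2 + s) k‖ ≤ ‖poch (b + 1) k‖ * (2 / (k + 2)) := by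
  induction k with
  | zero => simp
  | succ k ih =>
    rw [poch_succ, poch_succ, norm_mul, norm_mul]
    refine (mul_le_mul ih (norm_half_add_le hb hs0 hs k) (norm_nonneg _) (by positivity)).trans_eq ?_
    push_cast
    field_simp
    ring

theorem norm_firstTerm_le {b : ℂ} (hb : 2 ≤ b.re) (k : ℕ) :
    ‖firstTerm b k‖ ≤ 4 / ((k : ℝ) + 2) ^ 2 := by
  have h0 : 0 < ‖poch (b + 1) k‖ := norm_pos_iff.2 <|
    poch_ne_zero (admissible_of_re (by linarith)).add_ne_zero k
  have h1 := norm_poch_half_le hb (s := 1 / 4) (by norm_num) (by norm_num) k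
  have h2 := norm_poch_half_le hb (s := 3 / 4) (by norm_num) (by norm_num) k
  push_cast at h1 h2
  rw [firstTerm, norm_div, norm_mul, norm_pow, div_le_iff₀ (by positivity)]
  refine (mul_le_mul h1 h2 (norm_nonneg _) (by positivity)).trans_eq ?_
  field_simp
  ring

theorem summable_firstTerm_bound : Summable fun k : ℕ => 4 / ((k : ℝ) + 2) ^ 2 := by
  have h := ((summable_nat_add_iff 2).2 (Real.summable_one_div_nat_pow.2 one_lt_two)).mul_left 4
  refine h.congr fun k => ?_
  push_cast
  ring

/-- The difference at `a` is `fCoeff a n` times the difference at `a + n`, which is `O(1 + n)`; the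
product tends to zero. -/
theorem f_eq_first {a : ℂ} (ha : Admissible a) (hs : Summable (firstTerm a)) :
    f a = 4 * a * ∑' n : ℕ, firstTerm a n := by
  have hsn : ∀ n : ℕ, Summable (firstTerm (a + n)) := fun n => by
    induction n with
    | zero => simpa using hs
    | succ n ih =>
      have := summable_firstTerm_add_one (ha.add_nat n) ih
      push_cast
      rwa [← add_assoc]
  set h : ℂ → ℂ := fun b => f b - 4 * b * ∑' n : ℕ, firstTerm b n with hh
  have hrec : ∀ n : ℕ, h (a + n) = recFactor (a + n) * h (a + n + 1) := fun n => by
    simp only [hh]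
    rw [f_recurrence, first_recurrence (ha.add_nat n) (hsn n)]
    ring
  obtain ⟨C, hC, hf⟩ := exists_norm_f_le
  set S := ∑' k : ℕ, 4 / ((k : ℝ) + 2) ^ 2 with hS
  have hS0 : 0 ≤ S := tsum_nonneg fun k => by positivity
  have hbound : ∀ᶠ n : ℕ in atTop, ‖h a‖ ≤
      ((C + 4 * S) * (1 + ‖a‖)) * ‖(1 + (n : ℂ)) ^ 1 * fCoeff a n‖ := by
    filter_upwards [tendsto_natCast_atTop_atTop.eventually_ge_atTop (2 - a.re)] with n hn
    have hre : 2 ≤ (a + n).re := by simp; linarith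
    rw [eq_fCoeff_mul_of_recurrence hrec n, norm_mul, norm_mul, pow_one]
    have h1 : ‖1 + (n : ℂ)‖ = 1 + n := by
      exact_mod_cast Complex.norm_natCast (1 + n)
    have h2 : ‖a + n‖ ≤ ‖a‖ + n := (norm_add_le _ _).trans (by simp)
    have h3 : ‖∑' k : ℕ, firstTerm (a + n) k‖ ≤ S :=
      tsum_of_norm_bounded summable_firstTerm_bound.hasSum (norm_firstTerm_le hre)
    have h4 : ‖h (a + n)‖ ≤ (C + 4 * S) * (1 + ‖a + n‖) := by
      refine (norm_sub_le _ _).trans ?_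
      rw [norm_mul, norm_mul]
      have := hf (a + n) (by linarith)
      have h5 : ‖(4 : ℂ)‖ * ‖a + n‖ * ‖∑' k : ℕ, firstTerm (a + n) k‖ ≤ 4 * ‖a + n‖ * S := by
        rw [show ‖(4 : ℂ)‖ = 4 by norm_num]
        gcongr
      nlinarith [norm_nonneg (a + n)]
    have h5 : 1 + ‖a + n‖ ≤ (1 + ‖a‖) * (1 + n) := by
      nlinarith [norm_nonneg a, mul_nonneg (norm_nonneg a) (n.cast_nonneg (α := ℝ))]
    rw [h1]
    calc ‖fCoeff a n‖ * ‖h (a + n)‖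
        ≤ ‖fCoeff a n‖ * ((C + 4 * S) * ((1 + ‖a‖) * (1 + n))) := by
          gcongr
          exact h4.trans (by gcongr)
      _ = _ := by ring
  have hlim := ((summable_natCast_pow_mul_fCoeff a 1).tendsto_atTop_zero.norm).const_mul
    ((C + 4 * S) * (1 + ‖a‖))
  rw [norm_zero, mul_zero] at hlim
  have := ge_of_tendsto hlim hbound
  exact sub_eq_zero.1 (norm_le_zero_iff.1 this)

/-! ### The recurrence of the second series -/

/-- The parameters at which `cos (π a)` does not vanish. -/
def NotHalfInteger (a : ℂ) : Prop := ∀ m : ℤ, a ≠ m + 1 / 2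

theorem notHalfInteger_iff {a : ℂ} : NotHalfInteger a ↔ Complex.cos (Real.pi * a) ≠ 0 := by
  rw [Ne, Complex.cos_eq_zero_iff, not_exists]
  have hpi : (Real.pi : ℂ) ≠ 0 := by exact_mod_cast Real.pi_ne_zero
  refine forall_congr' fun m => not_congr ⟨fun h => ?_, fun h => ?_⟩
  · rw [h]
    ring
  · refine mul_left_cancel₀ hpi ?_
    rw [h]
    ring

theorem NotHalfInteger.add_int {a : ℂ} (ha : NotHalfInteger a) (n : ℤ) :
    NotHalfInteger (a + n) := by
  intro m h
  exact ha (m - n) (by push_cast; linear_combination h)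

theorem NotHalfInteger.add_one {a : ℂ} (ha : NotHalfInteger a) : NotHalfInteger (a + 1) := by
  simpa using ha.add_int 1

theorem NotHalfInteger.half_sub_ne {a : ℂ} (ha : NotHalfInteger a) (j : ℕ) :
    1 / 2 - a + j ≠ 0 := by
  intro h
  exact ha j (by push_cast; linear_combination -h)

theorem NotHalfInteger.three_half_sub_ne {a : ℂ} (ha : NotHalfInteger a) (j : ℕ) :
    3 / 2 - a + j ≠ 0 := by
  intro h
  exact ha (j + 1) (by push_cast; linear_combination -h)

theorem NotHalfInteger.half_sub_ne_zero {a : ℂ} (ha : NotHalfInteger a) : 1 / 2 - a ≠ 0 := by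
  simpa using ha.half_sub_ne 0

theorem NotHalfInteger.half_add_ne_zero {a : ℂ} (ha : NotHalfInteger a) : a + 1 / 2 ≠ 0 := by
  intro h
  exact ha (-1) (by push_cast; linear_combination h)

theorem secondTerm_succ (a : ℂ) (k : ℕ) : secondTerm a (k + 1) =
    secondTerm a k * (1 / 2 * ((a + 1 / 2 + k) / (a + 1 + k) * ((a + 1 / 2 + k) / (3 / 2 - a + k)))) := by
  rw [secondTerm, secondTerm, poch_succ, poch_succ, poch_succ, pow_succ]
  rw [mul_pow, mul_mul_mul_comm (poch (a + 1) k), mul_div_mul_comm _ _ (_ * poch (3 / 2 - a) k),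
    div_mul_div_comm (a + 1 / 2 + k)]
  ring

theorem tendsto_secondTerm_ratio (a : ℂ) : Tendsto (fun k : ℕ => 1 / 2 * ((a + 1 / 2 + k) /
    (a + 1 + k) * ((a + 1 / 2 + k) / (3 / 2 - a + k)))) atTop (𝓝 (1 / 2)) := by
  simpa using ((tendsto_add_div_add_natCast (a + 1 / 2) (a + 1)).mul
    (tendsto_add_div_add_natCast (a + 1 / 2) (3 / 2 - a))).const_mul (1 / 2 : ℂ)

theorem summable_natCast_pow_mul_secondTerm (a : ℂ) (p : ℕ) :
    Summable fun k : ℕ => (1 + (k : ℂ)) ^ p * secondTerm a k :=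
  summable_natCast_pow_mul_of_ratio p (secondTerm_succ a) (tendsto_secondTerm_ratio a) (by norm_num)

theorem summable_secondTerm (a : ℂ) : Summable (secondTerm a) := by
  simpa using summable_natCast_pow_mul_secondTerm a 0

theorem secondTerm_add_one {a : ℂ} (ha : Admissible a) (hh : NotHalfInteger a) (k : ℕ) :
    secondTerm (a + 1) k = secondTerm a k * (((a + 1 / 2 + k) / (a + 1 / 2)) ^ 2 *
      ((a + 1) / (a + 1 + k)) * ((1 / 2 - a + k) / (1 / 2 - a))) := by
  have h1 := mul_poch_add_one (a + 1 / 2) k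
  have h2 := mul_poch_add_one (a + 1) k
  have h3 := mul_poch_add_one (1 / 2 - a) k
  rw [show 1 / 2 - a + 1 = 3 / 2 - a by ring] at h3
  have n1 := ha.one_ne_zero
  have n2 := ha.add_ne_zero k
  have n3 := hh.half_add_ne_zero
  have n4 := hh.half_sub_ne_zero
  have n5 := hh.half_sub_ne k
  have n6 : poch (a + 1) k ≠ 0 := poch_ne_zero ha.add_ne_zero k
  have n7 : poch (1 / 2 - a) k ≠ 0 := poch_ne_zero hh.half_sub_ne k
  rw [secondTerm, secondTerm, show a + 1 + 1 / 2 = a + 1 / 2 + 1 by ring,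
    show 3 / 2 - (a + 1) = 1 / 2 - a by ring, eq_div_of_mul_eq n3 ((mul_comm _ _).trans h1),
    eq_div_of_mul_eq n1 ((mul_comm _ _).trans h2), eq_div_of_mul_eq n4 ((mul_comm _ _).trans h3)]
  generalize poch (a + 1) k = r at *
  generalize poch (1 / 2 - a) k = q at *
  generalize poch (a + 1 / 2) k = p at *
  generalize a + 1 / 2 + k = e at *
  generalize 1 / 2 - a + k = e1 at *
  generalize 1 / 2 - a = e2 at *
  generalize a + 1 / 2 = e3 at *
  field_simp

/-- The certificate is `(1/2 - a + k) / (1/2 - a) * (6 * a + 1 + 2 * k)`, again equal to `6 * a + 1`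
at `k = 0`. Divided by `secondTerm a k`, the claim is an identity of rational functions. -/
theorem secondTerm_telescope {a : ℂ} (ha : Admissible a) (hh : NotHalfInteger a) (k : ℕ) :
    recFactor a * (16 * (a + 1) ^ 2 / (2 * (a + 1) - 1) * secondTerm (a + 1) k) -
        16 * a ^ 2 / (2 * a - 1) * secondTerm a k =
      secondTerm a (k + 1) * ((1 / 2 - a + (k + 1 : ℕ)) / (1 / 2 - a) * (6 * a + 1 + 2 * (k + 1 : ℕ)))
        - secondTerm a k * ((1 / 2 - a + k) / (1 / 2 - a) * (6 * a + 1 + 2 * k)) := by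
  have n1 := ha.one_ne_zero
  have n2 := ha.add_ne_zero k
  have n3 := hh.half_add_ne_zero
  have n4 := hh.half_sub_ne_zero
  have n5 := hh.three_half_sub_ne k
  have e1 : 2 * a - 1 = -2 * (1 / 2 - a) := by ring
  have e2 : 2 * (a + 1) - 1 = 2 * (a + 1 / 2) := by ring
  have e3 : 1 / 2 - a + ((k + 1 : ℕ) : ℂ) = 3 / 2 - a + k := by push_cast; ring
  have key : recFactor a * (16 * (a + 1) ^ 2 / (2 * (a + 1 / 2)) * (((a + 1 / 2 + k) / (a + 1 / 2)) ^ 2 *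
      ((a + 1) / (a + 1 + k)) * ((1 / 2 - a + k) / (1 / 2 - a)))) =
      -(a + 1 / 2 + k) ^ 2 * (1 / 2 - a + k) / ((a + 1 + k) * (1 / 2 - a)) := by
    rw [recFactor]
    generalize a + 1 / 2 + k = u
    generalize 1 / 2 - a + k = v
    generalize a + 1 / 2 = w at *
    field_simp
    ring
  have key2 : (1 / 2 * ((a + 1 / 2 + k) / (a + 1 + k) * ((a + 1 / 2 + k) / (3 / 2 - a + k)))) *
      ((3 / 2 - a + k) / (1 / 2 - a) * (6 * a + 1 + 2 * (k + 1 : ℕ))) =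
      1 / 2 * (a + 1 / 2 + k) ^ 2 * (6 * a + 1 + 2 * (k + 1 : ℕ)) / ((a + 1 + k) * (1 / 2 - a)) := by
    generalize a + 1 / 2 + k = u
    generalize 3 / 2 - a + k = v at *
    generalize 1 / 2 - a = w at *
    field_simp
  rw [secondTerm_add_one ha hh, secondTerm_succ, e1, e2, e3]
  have : -(a + 1 / 2 + k) ^ 2 * (1 / 2 - a + k) / ((a + 1 + k) * (1 / 2 - a))
      - 16 * a ^ 2 / (-2 * (1 / 2 - a)) =
      1 / 2 * (a + 1 / 2 + k) ^ 2 * (6 * a + 1 + 2 * (k + 1 : ℕ)) / ((a + 1 + k) * (1 / 2 - a))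
      - (1 / 2 - a + k) / (1 / 2 - a) * (6 * a + 1 + 2 * k) := by
    push_cast
    have n4' : 1 - 2 * a ≠ 0 := fun h => n4 (by linear_combination h / 2)
    rw [show 1 / 2 - a = (1 - 2 * a) / 2 by ring]
    field_simp
    ring
  linear_combination secondTerm a k * (key - key2 + this)

/-- The second series together with its prefactor. -/
noncomputable def second (a : ℂ) : ℂ := 16 * a ^ 2 / (2 * a - 1) * ∑' n : ℕ, secondTerm a n

theorem second_recurrence {a : ℂ} (ha : Admissible a) (hh : NotHalfInteger a) :
    second a = 6 * a + 1 + recFactor a * second (a + 1) := by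
  have hG : Tendsto (fun k : ℕ => secondTerm a k * ((1 / 2 - a + k) / (1 / 2 - a) *
      (6 * a + 1 + 2 * k))) atTop (𝓝 0) := by
    have h (p : ℕ) := (summable_natCast_pow_mul_secondTerm a p).tendsto_atTop_zero
    -- These are the coefficients of `(1/2 - a + k) * (6 * a + 1 + 2 * k)` in powers of `1 + k`.
    have h1 := (((h 2).const_mul 2).add ((h 1).const_mul (4 * a - 2))).add
      ((h 0).const_mul (-(a + 1 / 2) * (6 * a - 1)))
    have h2 := h1.div_const (1 / 2 - a)
    simp only [mul_zero, add_zero, zero_div] at h2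
    refine h2.congr fun k => ?_
    ring
  have := tsum_telescope ((summable_secondTerm (a + 1)).mul_left (16 * (a + 1) ^ 2 / (2 * (a + 1) - 1)))
    ((summable_secondTerm a).mul_left (16 * a ^ 2 / (2 * a - 1))) hG (secondTerm_telescope ha hh)
  rw [tsum_mul_left, tsum_mul_left] at this
  rw [second, second, this]
  simp only [secondTerm, poch_zero, Nat.cast_zero, add_zero, mul_zero,
    div_self hh.half_sub_ne_zero]
  norm_num

/-! ### Analyticity of the two series -/

theorem differentiable_poch (n : ℕ) : Differentiable ℂ fun x => poch x n := by
  unfold poch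
  fun_prop

theorem differentiableOn_f : DifferentiableOn ℂ f {a | -(1 / 4) < a.re} := by
  have hopen : IsOpen {a : ℂ | -(1 / 4) < a.re} := isOpen_lt continuous_const Complex.continuous_re
  intro a ha
  set R := ‖a‖ + 1
  -- The bound on the terms grows with `‖a‖`, so the Weierstrass test is applied on bounded pieces.
  have hU : IsOpen ({a : ℂ | -(1 / 4) < a.re} ∩ Metric.ball 0 R) := hopen.inter Metric.isOpen_ball
  have h : DifferentiableOn ℂ (fun w : ℂ => ∑' n, fTerm w n)
      ({a : ℂ | -(1 / 4) < a.re} ∩ Metric.ball 0 R) := by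
    refine Complex.differentiableOn_tsum_of_summable_norm
      (summable_fTerm_bound.mul_right (1 + R)) (fun n => ?_) hU fun n w hw => ?_
    · intro w hw
      have hw1 : -(1 / 4) < w.re := hw.1
      have h1 : poch (w + 1) n ≠ 0 :=
        poch_ne_zero (admissible_of_re (by linarith)).add_ne_zero n
      have d1 : Differentiable ℂ fun x => poch (x + 1 / 2) n :=
        (differentiable_poch n).comp (differentiable_id.add_const _)
      have d2 : Differentiable ℂ fun x => poch (x + 1) n :=
        (differentiable_poch n).comp (differentiable_id.add_const _)
      refine DifferentiableAt.differentiableWithinAt ?_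
      unfold fTerm
      refine DifferentiableAt.mul (DifferentiableAt.const_mul (DifferentiableAt.div
        ((d1 w).pow 3) ((d2 w).pow 3) (pow_ne_zero 3 h1)) _) (by fun_prop)
    · have hw1 : -(1 / 4) < w.re := hw.1
      have hw2 : ‖w‖ < R := by simpa using hw.2
      refine (norm_fTerm_le (by linarith) n).trans ?_
      gcongr
  have ha' : a ∈ {a : ℂ | -(1 / 4) < a.re} ∩ Metric.ball 0 R := ⟨ha, by simp [R]⟩
  exact (h.differentiableAt (hU.mem_nhds ha')).differentiableWithinAt

/-- The strip on which the two series are compared. -/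
def strip : Set ℂ := {a | -(1 / 4) < a.re ∧ a.re < 5 / 4}

theorem isOpen_strip : IsOpen strip :=
  (isOpen_lt continuous_const Complex.continuous_re).inter
    (isOpen_lt Complex.continuous_re continuous_const)

theorem isPreconnected_strip : IsPreconnected strip := by
  have : strip = Complex.re ⁻¹' Set.Ioo (-(1 / 4)) (5 / 4) := rfl
  rw [this]
  exact ((convex_Ioo _ _).linear_preimage Complex.reLm).isPreconnected

/-- The constant is the ratio of the real parts at the right edge `re a = 5/4`. The product of these
ratios grows at most quadratically, which `2 ^ (-n)` absorbs. -/
theorem norm_half_add_le_norm_three_half_sub {a : ℂ} (ha : a ∈ strip) (j : ℕ) :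
    ‖a + 1 / 2 + j‖ ≤ ‖3 / 2 - a + j‖ * ((4 * j + 7) / (4 * j + 1)) := by
  obtain ⟨h1, h2⟩ := ha
  have hj : (0 : ℝ) ≤ j := j.cast_nonneg
  have : ‖3 / 2 - a + j‖ * ((4 * (j : ℝ) + 7) / (4 * j + 1)) =
      ‖(3 / 2 - a + j) * (((4 * j + 7) / (4 * j + 1) : ℝ) : ℂ)‖ := by
    rw [norm_mul, Complex.norm_real, Real.norm_of_nonneg (by positivity)]
  rw [this]
  have h3 : (1 : ℝ) ≤ (4 * j + 7) / (4 * j + 1) := by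
    rw [le_div_iff₀ (by positivity)]
    linarith
  refine norm_le_norm_of_re_im ?_ ?_
  · rw [Complex.re_mul_ofReal]
    simp
    refine pow_le_pow_left₀ (by linarith) ?_ 2
    rw [mul_div_assoc', le_div_iff₀ (by positivity)]
    nlinarith
  · rw [Complex.im_mul_ofReal]
    simp
    rw [mul_pow]
    exact le_mul_of_one_le_right (sq_nonneg _) (one_le_pow₀ h3)

theorem norm_poch_half_le_three_half {a : ℂ} (ha : a ∈ strip) (n : ℕ) :
    ‖poch (a + 1 / 2) n‖ ≤ ‖poch (3 / 2 - a) n‖ * ((4 * n + 1) * (4 * n + 5) / 5) := by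
  induction n with
  | zero => simp
  | succ k ih =>
    rw [poch_succ, poch_succ, norm_mul, norm_mul]
    refine (mul_le_mul ih (norm_half_add_le_norm_three_half_sub ha k) (norm_nonneg _)
      (by positivity)).trans ?_
    have : ((4 * (k : ℝ) + 1) * (4 * k + 5) / 5) * ((4 * k + 7) / (4 * k + 1)) ≤
        (4 * (k + 1 : ℕ) + 1) * (4 * (k + 1 : ℕ) + 5) / 5 := by
      push_cast
      rw [div_mul_div_comm, div_le_div_iff₀ (by positivity) (by norm_num)]
      nlinarith [k.cast_nonneg (α := ℝ), sq_nonneg (k : ℝ),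
        mul_nonneg (k.cast_nonneg (α := ℝ)) (sq_nonneg (k : ℝ))]
    calc _ = (‖poch (3 / 2 - a) k‖ * ‖3 / 2 - a + k‖) *
          (((4 * (k : ℝ) + 1) * (4 * k + 5) / 5) * ((4 * k + 7) / (4 * k + 1))) := by ring
      _ ≤ _ := by gcongr

theorem three_half_sub_ne_of_mem_strip {a : ℂ} (ha : a ∈ strip) (j : ℕ) : 3 / 2 - a + j ≠ 0 := by
  intro h
  have h1 := congrArg Complex.re h
  simp at h1
  linarith [ha.2, j.cast_nonneg (α := ℝ)]

theorem norm_secondTerm_le {a : ℂ} (ha : a ∈ strip) (n : ℕ) :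
    ‖secondTerm a n‖ ≤ (1 / 2) ^ n * ((4 * n + 1) * (4 * n + 5) / 5) := by
  have h1 := norm_poch_half_div_le_one (a := a) (by linarith [ha.1]) n
  have h2 : ‖poch (a + 1 / 2) n / poch (3 / 2 - a) n‖ ≤ (4 * n + 1) * (4 * n + 5) / 5 := by
    rw [norm_div, div_le_iff₀
      (norm_pos_iff.2 (poch_ne_zero (three_half_sub_ne_of_mem_strip ha) n)), mul_comm]
    exact norm_poch_half_le_three_half ha n
  have h3 : secondTerm a n = (1 / 2) ^ n * (poch (a + 1 / 2) n / poch (a + 1) n *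
      (poch (a + 1 / 2) n / poch (3 / 2 - a) n)) := by
    rw [secondTerm, div_mul_div_comm, one_div_pow]
    ring
  rw [h3, norm_mul, norm_mul, norm_pow]
  have h4 : ‖(1 / 2 : ℂ)‖ = 1 / 2 := by norm_num
  rw [h4]
  refine mul_le_mul_of_nonneg_left ?_ (by positivity)
  calc _ ≤ 1 * ((4 * (n : ℝ) + 1) * (4 * n + 5) / 5) :=
        mul_le_mul h1 h2 (norm_nonneg _) zero_le_one
    _ = _ := one_mul _

theorem summable_secondTerm_bound :
    Summable fun n : ℕ => (1 / 2 : ℝ) ^ n * ((4 * n + 1) * (4 * n + 5) / 5) := by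
  have h (p : ℕ) := summable_pow_mul_geometric_of_norm_lt_one (R := ℝ) p (r := 1 / 2) (by norm_num)
  refine ((((h 2).mul_left (16 / 5)).add ((h 1).mul_left (24 / 5))).add (h 0)).congr fun n => ?_
  ring

theorem differentiableOn_tsum_secondTerm :
    DifferentiableOn ℂ (fun a => ∑' n, secondTerm a n) strip := by
  refine Complex.differentiableOn_tsum_of_summable_norm summable_secondTerm_bound (fun n => ?_)
    isOpen_strip fun n w hw => norm_secondTerm_le hw n
  intro w hw
  have h1 : poch (w + 1) n ≠ 0 :=
    poch_ne_zero (admissible_of_re (by linarith [hw.1])).add_ne_zero n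
  have h2 : poch (3 / 2 - w) n ≠ 0 := poch_ne_zero (three_half_sub_ne_of_mem_strip hw) n
  have d1 : Differentiable ℂ fun x => poch (x + 1 / 2) n :=
    (differentiable_poch n).comp (differentiable_id.add_const _)
  have d2 : Differentiable ℂ fun x => poch (x + 1) n :=
    (differentiable_poch n).comp (differentiable_id.add_const _)
  have d3 : Differentiable ℂ fun x => poch (3 / 2 - x) n :=
    (differentiable_poch n).comp (differentiable_id.const_sub _)
  refine DifferentiableAt.differentiableWithinAt ?_
  unfold secondTerm
  exact ((((d1 w).pow 2).div ((d2 w).mul (d3 w)) (mul_ne_zero h1 h2))).const_mul _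

theorem exists_norm_tsum_secondTerm_le :
    ∃ C : ℝ, 0 ≤ C ∧ ∀ a ∈ strip, ‖∑' n, secondTerm a n‖ ≤ C :=
  ⟨_, tsum_nonneg fun n => by positivity, fun _ ha =>
    tsum_of_norm_bounded summable_secondTerm_bound.hasSum (norm_secondTerm_le ha)⟩

/-! ### The Gamma factor -/

/-- The quotient `Γ(a + 1/2) / Γ(a + 1)`. -/
noncomputable def gammaRatio (a : ℂ) : ℂ := Complex.Gamma (a + 1 / 2) / Complex.Gamma (a + 1)

/-- The Gamma factor `8^{-a} ((1/2)_a / (1)_a)³`, which turns the recurrence of `f` into antiperiodicity. -/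
noncomputable def gammaFactor (a : ℂ) : ℂ :=
  (8 : ℂ) ^ (-a) * (gammaRatio a / Complex.Gamma (1 / 2)) ^ 3

theorem gammaRatio_add_one {a : ℂ} (ha : Admissible a) (h : a + 1 / 2 ≠ 0) :
    gammaRatio (a + 1) = gammaRatio a * ((a + 1 / 2) / (a + 1)) := by
  rw [gammaRatio, gammaRatio, show a + 1 + 1 / 2 = a + 1 / 2 + 1 by ring,
    Complex.Gamma_add_one _ h, Complex.Gamma_add_one _ ha.one_ne_zero, div_mul_div_comm]
  ring

theorem gammaFactor_add_one {a : ℂ} (ha : Admissible a) (h : a + 1 / 2 ≠ 0) :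
    gammaFactor (a + 1) = -(gammaFactor a * recFactor a) := by
  rw [gammaFactor, gammaFactor, gammaRatio_add_one ha h, recFactor, neg_add,
    Complex.cpow_add _ _ (by norm_num), Complex.cpow_neg_one]
  ring

theorem differentiableOn_gammaFactor : DifferentiableOn ℂ gammaFactor {a | -(1 / 4) < a.re} := by
  intro a ha
  have ha : -(1 / 4) < a.re := ha
  have h1 : DifferentiableAt ℂ (fun a => Complex.Gamma (a + 1 / 2)) a := by
    refine DifferentiableAt.comp (g := Complex.Gamma) a
      (Complex.differentiableAt_Gamma _ fun m h => ?_) (by fun_prop)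
    have h1 := congrArg Complex.re h
    simp at h1
    linarith [m.cast_nonneg (α := ℝ)]
  have h2 : DifferentiableAt ℂ (fun a => Complex.Gamma (a + 1)) a := by
    refine DifferentiableAt.comp (g := Complex.Gamma) a
      (Complex.differentiableAt_Gamma _ fun m h => ?_) (by fun_prop)
    have h1 := congrArg Complex.re h
    simp at h1
    linarith [m.cast_nonneg (α := ℝ)]
  have h3 : Complex.Gamma (a + 1) ≠ 0 :=
    Complex.Gamma_ne_zero_of_re_pos (by simp; linarith)
  refine DifferentiableAt.differentiableWithinAt ?_
  refine DifferentiableAt.mul ?_ (DifferentiableAt.pow ((h1.div h2 h3).div_const _) 3)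
  exact DifferentiableAt.const_cpow (by fun_prop) (Or.inl (by norm_num))

theorem gammaFactor_ne_zero {a : ℂ} (ha : -(1 / 4) < a.re) : gammaFactor a ≠ 0 := by
  have h1 : Complex.Gamma (a + 1 / 2) ≠ 0 :=
    Complex.Gamma_ne_zero_of_re_pos (by simp; linarith)
  have h2 : Complex.Gamma (a + 1) ≠ 0 :=
    Complex.Gamma_ne_zero_of_re_pos (by simp; linarith)
  have h3 : Complex.Gamma (1 / 2) ≠ 0 := Complex.Gamma_ne_zero_of_re_pos (by norm_num)
  exact mul_ne_zero (by rw [Ne, Complex.cpow_eq_zero_iff]; norm_num)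
    (pow_ne_zero _ (div_ne_zero (div_ne_zero h1 h2) h3))

/-- Up to the constant `Γ(1/2)` the quotient is the Beta integral `B(a + 1/2, 1/2)`, whose integrand
is largest in modulus at `re a = 0`. -/
theorem exists_norm_gammaRatio_le :
    ∃ C : ℝ, 0 ≤ C ∧ ∀ a : ℂ, 0 ≤ a.re → ‖gammaRatio a‖ ≤ C := by
  have h3 : Complex.Gamma (1 / 2) ≠ 0 := Complex.Gamma_ne_zero_of_re_pos (by norm_num)
  set I : ℝ := ∫ x : ℝ in (0 : ℝ)..1, ‖(x : ℂ) ^ ((1 / 2 : ℂ) - 1) * (1 - (x : ℂ)) ^ ((1 / 2 : ℂ) - 1)‖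
  have hI : 0 ≤ I := intervalIntegral.integral_nonneg zero_le_one fun x _ => norm_nonneg _
  refine ⟨I / ‖Complex.Gamma (1 / 2)‖, by positivity, fun a ha => ?_⟩
  have h1 : Complex.Gamma (a + 1) ≠ 0 := Complex.Gamma_ne_zero_of_re_pos (by simp; linarith)
  have h2 := Complex.Gamma_mul_Gamma_eq_betaIntegral (s := a + 1 / 2) (t := 1 / 2)
    (by simp; linarith) (by norm_num)
  rw [show a + 1 / 2 + 1 / 2 = a + 1 by ring] at h2
  have h4 : gammaRatio a = Complex.betaIntegral (a + 1 / 2) (1 / 2) / Complex.Gamma (1 / 2) := by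
    rw [gammaRatio, div_eq_div_iff h1 h3, h2]
    ring
  rw [h4, norm_div]
  gcongr
  rw [Complex.betaIntegral]
  refine intervalIntegral.norm_integral_le_of_norm_le zero_le_one ?_
    (Complex.betaIntegral_convergent (u := 1 / 2) (v := 1 / 2) (by norm_num) (by norm_num)).norm
  refine Eventually.of_forall fun x hx => ?_
  rw [norm_mul, norm_mul]
  refine mul_le_mul_of_nonneg_right ?_ (norm_nonneg _)
  rw [Complex.norm_cpow_eq_rpow_re_of_pos hx.1, Complex.norm_cpow_eq_rpow_re_of_pos hx.1]
  refine Real.rpow_le_rpow_of_exponent_ge hx.1 hx.2 ?_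
  simp
  linarith

theorem norm_gammaFactor_eq (a : ℂ) :
    ‖gammaFactor a‖ = 8 ^ (-a.re) * (‖gammaRatio a‖ / ‖Complex.Gamma (1 / 2)‖) ^ 3 := by
  rw [gammaFactor, norm_mul, norm_pow, norm_div]
  congr 1
  have := Complex.norm_cpow_eq_rpow_re_of_pos (x := 8) (by norm_num) (-a)
  simpa using this

/-- On the imaginary axis conjugation is negation, so the reflection formula evaluates both squared
moduli; their quotient is `tanh (π y) / y`. -/
theorem norm_gammaRatio_I_mul_sq (y : ℝ) (hy : y ≠ 0) :
    ‖gammaRatio (y * Complex.I)‖ ^ 2 ≤ 1 / |y| := by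
  have hy' : (y : ℂ) ≠ 0 := by exact_mod_cast hy
  have hyI : (y : ℂ) * Complex.I ≠ 0 := mul_ne_zero hy' Complex.I_ne_zero
  have hpi : (Real.pi : ℂ) ≠ 0 := by exact_mod_cast Real.pi_ne_zero
  set z := (y : ℂ) * Complex.I with hz
  have hconj : (starRingEnd ℂ) z = -z := by simp [hz]
  have h1 : (‖Complex.Gamma (z + 1 / 2)‖ : ℂ) ^ 2 = Real.pi / Complex.cos (Real.pi * z) := by
    rw [← Complex.mul_conj', ← Complex.Gamma_conj]
    have e : (starRingEnd ℂ) (z + 1 / 2) = 1 - (z + 1 / 2) := by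
      rw [map_add, hconj, map_div₀, map_one, map_ofNat]
      ring
    rw [e, Complex.Gamma_mul_Gamma_one_sub]
    congr 1
    rw [show (Real.pi : ℂ) * (z + 1 / 2) = Real.pi * z + Real.pi / 2 by ring,
      Complex.sin_add_pi_div_two]
  have h2 : (‖Complex.Gamma (z + 1)‖ : ℂ) ^ 2 = z * (Real.pi / Complex.sin (Real.pi * z)) := by
    rw [← Complex.mul_conj', ← Complex.Gamma_conj]
    have e : (starRingEnd ℂ) (z + 1) = 1 - z := by
      rw [map_add, hconj]
      simp
      ring
    rw [e, Complex.Gamma_add_one _ hyI, mul_assoc, Complex.Gamma_mul_Gamma_one_sub]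
  have h3 : (‖gammaRatio z‖ : ℂ) ^ 2 = Complex.sin (Real.pi * z) / (z * Complex.cos (Real.pi * z)) := by
    rw [gammaRatio, norm_div]
    push_cast
    rw [div_pow, h1, h2]
    field_simp
  have h4 : ‖gammaRatio z‖ ^ 2 =
      ‖Complex.sin (Real.pi * z)‖ / (‖z‖ * ‖Complex.cos (Real.pi * z)‖) := by
    rw [← norm_mul, ← norm_div, ← h3]
    simp
  have h5 : Real.pi * z = ((Real.pi * y : ℝ) : ℂ) * Complex.I := by
    rw [hz]
    push_cast
    ring
  have h6 : ‖z‖ = |y| := by simp [hz]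
  rw [h4, h5, Complex.sin_mul_I, Complex.cos_mul_I, h6, norm_mul, Complex.norm_I, mul_one,
    ← Complex.ofReal_sinh, ← Complex.ofReal_cosh, Complex.norm_real, Complex.norm_real,
    Real.norm_eq_abs, Real.norm_eq_abs, abs_of_pos (Real.cosh_pos _), ← div_div]
  have h7 : |Real.sinh (Real.pi * y)| ≤ Real.cosh (Real.pi * y) := by
    rw [abs_le]
    constructor
    · have := Real.exp_pos (Real.pi * y)
      rw [← Real.cosh_add_sinh] at this
      linarith
    · exact (Real.sinh_lt_cosh _).le
  rw [div_right_comm]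
  have := Real.cosh_pos (Real.pi * y)
  gcongr
  exact div_le_one_of_le₀ h7 this.le

/-- `|cos (x + i y)|² = cos² x + sinh² y`, and `|sinh y| ≥ |y|`. -/
theorem abs_im_le_norm_cos (z : ℂ) : |z.im| ≤ ‖Complex.cos z‖ := by
  refine le_of_sq_le_sq ?_ (norm_nonneg _)
  have h1 : Complex.cos z = ((Real.cos z.re * Real.cosh z.im : ℝ) : ℂ) +
      ((-(Real.sin z.re * Real.sinh z.im) : ℝ) : ℂ) * Complex.I := by
    rw [Complex.cos_eq z]
    push_cast
    ring
  have h2 : z.im ^ 2 ≤ Real.sinh z.im ^ 2 := by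
    rw [sq_le_sq, Real.abs_sinh]
    exact Real.self_le_sinh_iff.2 (abs_nonneg _)
  rw [Complex.sq_norm, h1, Complex.normSq_add_mul_I, sq_abs]
  nlinarith [Real.cosh_sq z.im, Real.sin_sq_add_cos_sq z.re, sq_nonneg (Real.cos z.re)]

/-! ### The second identity in a strip -/

/-- The quotient `cos (π a) / (a - 1/2)`, with its removable singularity removed. -/
noncomputable def cosQuot : ℂ → ℂ := dslope (fun a : ℂ => Complex.cos (Real.pi * a)) (1 / 2)

theorem cos_pi_half : Complex.cos (Real.pi * (1 / 2)) = 0 := by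
  rw [mul_one_div, Complex.cos_pi_div_two]

theorem sub_half_mul_cosQuot (a : ℂ) : (a - 1 / 2) * cosQuot a = Complex.cos (Real.pi * a) := by
  have := sub_smul_dslope (fun a : ℂ => Complex.cos (Real.pi * a)) (1 / 2) a
  simp only [cos_pi_half, sub_zero, smul_eq_mul] at this
  exact this

theorem cosQuot_half : cosQuot (1 / 2) = -Real.pi := by
  have h : HasDerivAt (fun a : ℂ => Complex.cos (Real.pi * a))
      (-Complex.sin (Real.pi * (1 / 2)) * (Real.pi * 1)) (1 / 2) :=
    (Complex.hasDerivAt_cos _).comp (1 / 2 : ℂ) ((hasDerivAt_id _).const_mul _)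
  rw [cosQuot, dslope_same, h.deriv, mul_one_div, Complex.sin_pi_div_two]
  ring

theorem differentiable_cosQuot : Differentiable ℂ cosQuot := by
  rw [← differentiableOn_univ, cosQuot, Complex.differentiableOn_dslope univ_mem]
  fun_prop

theorem notHalfInteger_of_mem_strip {a : ℂ} (ha : a ∈ strip) (h : a ≠ 1 / 2) :
    NotHalfInteger a := by
  intro m hm
  have h1 := congrArg Complex.re hm
  have h2 := ha.1
  have h3 := ha.2
  simp at h1
  rw [h1] at h2 h3
  have h4 : (-1 : ℝ) < m := by linarith
  have h5 : (m : ℝ) < 1 := by linarith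
  have h4' : -1 < m := by exact_mod_cast h4
  have h5' : m < 1 := by exact_mod_cast h5
  have : m = 0 := by omega
  subst this
  exact h (by simpa using hm)

theorem cosQuot_ne_zero {a : ℂ} (ha : a ∈ strip) : cosQuot a ≠ 0 := by
  by_cases h : a = 1 / 2
  · rw [h, cosQuot_half, neg_ne_zero]
    exact_mod_cast Real.pi_ne_zero
  · have h1 := notHalfInteger_iff.1 (notHalfInteger_of_mem_strip ha h)
    rw [← sub_half_mul_cosQuot] at h1
    exact right_ne_zero_of_mul h1

/-- The difference `f - second`, multiplied by `gammaFactor` and by `cos (π a)`. -/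
noncomputable def stripNumerator (a : ℂ) : ℂ :=
  gammaFactor a * (Complex.cos (Real.pi * a) * f a - 8 * a ^ 2 * cosQuot a * ∑' n, secondTerm a n)

theorem stripNumerator_eq {a : ℂ} (ha : a ≠ 1 / 2) :
    stripNumerator a = gammaFactor a * (f a - second a) * Complex.cos (Real.pi * a) := by
  have h : a - 1 / 2 ≠ 0 := sub_ne_zero.2 ha
  have h' : 2 * a - 1 ≠ 0 := fun h1 => h (by linear_combination h1 / 2)
  rw [stripNumerator, second, ← sub_half_mul_cosQuot]
  have : 16 * a ^ 2 / (2 * a - 1) * (a - 1 / 2) = 8 * a ^ 2 := by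
    rw [div_mul_eq_mul_div, div_eq_iff h']
    ring
  rw [← this]
  ring

theorem differentiableOn_stripNumerator : DifferentiableOn ℂ stripNumerator strip := by
  have hsub : strip ⊆ {a : ℂ | -(1 / 4) < a.re} := fun a ha => ha.1
  refine (differentiableOn_gammaFactor.mono hsub).mul (DifferentiableOn.sub
    (DifferentiableOn.mul (by fun_prop) (differentiableOn_f.mono hsub))
    (DifferentiableOn.mul (DifferentiableOn.mul (by fun_prop)
      differentiable_cosQuot.differentiableOn) differentiableOn_tsum_secondTerm))

/-- The difference of the two sides of the second identity, multiplied by `gammaFactor`, with its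
singularity at `1 / 2` removed. -/
noncomputable def stripDiff (a : ℂ) : ℂ := dslope stripNumerator (1 / 2) a / cosQuot a

theorem half_mem_strip : (1 / 2 : ℂ) ∈ strip := by
  constructor <;> norm_num

theorem differentiableOn_stripDiff : DifferentiableOn ℂ stripDiff strip := by
  refine DifferentiableOn.div ?_ differentiable_cosQuot.differentiableOn
    fun a ha => cosQuot_ne_zero ha
  rw [Complex.differentiableOn_dslope (isOpen_strip.mem_nhds half_mem_strip)]
  exact differentiableOn_stripNumerator

/-- The factor `a - 1/2` in the slope of `stripNumerator` combines with `cosQuot` to `cos (π a)`: a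
multiple of `1 / cos (π a)` has been subtracted to cancel the pole. -/
theorem stripDiff_eq {a : ℂ} (ha : a ∈ strip) (h : a ≠ 1 / 2) :
    stripDiff a = gammaFactor a * (f a - second a) -
      stripNumerator (1 / 2) / Complex.cos (Real.pi * a) := by
  have h1 := notHalfInteger_iff.1 (notHalfInteger_of_mem_strip ha h)
  have h2 := cosQuot_ne_zero ha
  have h3 : a - 1 / 2 ≠ 0 := sub_ne_zero.2 h
  rw [stripDiff, dslope_of_ne _ h, slope_def_field, stripNumerator_eq h, div_div,
    sub_half_mul_cosQuot, sub_div, mul_div_cancel_right₀ _ h1]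

/-- The inhomogeneous terms cancel in `f - second`, `gammaFactor` trades `recFactor` for a sign, and
`cos (π a)` changes sign as well. -/
theorem stripDiff_add_one {a : ℂ} (ha : a ∈ strip) (ha' : a + 1 ∈ strip) :
    stripDiff (a + 1) = -stripDiff a := by
  have hre : a.re < 1 / 4 := by
    have := ha'.2
    simp at this
    linarith
  have h : a ≠ 1 / 2 := by
    rintro rfl
    norm_num at hre
  have h' : a + 1 ≠ 1 / 2 := by
    intro h
    have := ha.1
    rw [eq_sub_of_add_eq h] at this
    norm_num at this
  have hN := notHalfInteger_of_mem_strip ha h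
  have hA : Admissible a := admissible_of_re (by linarith [ha.1])
  rw [stripDiff_eq ha h, stripDiff_eq ha' h', gammaFactor_add_one hA hN.half_add_ne_zero,
    f_recurrence a, second_recurrence hA hN, mul_add, mul_one, Complex.cos_add_pi]
  ring

theorem exists_norm_stripDiff_le : ∃ C : ℝ, 0 ≤ C ∧ ∀ a : ℂ, 0 ≤ a.re → a.re ≤ 1 → 1 ≤ |a.im| →
    ‖stripDiff a‖ ≤ C * ‖gammaRatio a‖ ^ 3 * (1 + |a.im|) + C / |a.im| := by
  obtain ⟨C₁, hC₁, hf⟩ := exists_norm_f_le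
  obtain ⟨C₂, hC₂, hs⟩ := exists_norm_tsum_secondTerm_le
  set c := ‖stripNumerator (1 / 2)‖
  set K := (2 * C₁ + 32 * C₂) / ‖Complex.Gamma (1 / 2)‖ ^ 3
  have hK : 0 ≤ K := by positivity
  refine ⟨K + c, by positivity, fun a h0 h1 hy => ?_⟩
  have ha : a ∈ strip := ⟨by linarith, by linarith⟩
  have hne : a ≠ 1 / 2 := by
    rintro rfl
    norm_num at hy
  have hpos : 0 < |a.im| := by linarith
  have hna : ‖a‖ ≤ 1 + |a.im| := by
    refine (Complex.norm_le_abs_re_add_abs_im a).trans ?_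
    rw [abs_of_nonneg h0]
    linarith
  have hfa : ‖f a‖ ≤ 2 * C₁ * (1 + |a.im|) := by
    refine (hf a (by linarith)).trans ?_
    nlinarith
  have hsa : ‖second a‖ ≤ 32 * C₂ * (1 + |a.im|) := by
    have h2 : 2 * |a.im| ≤ ‖2 * a - 1‖ := by
      refine le_trans (le_of_eq ?_) (Complex.abs_im_le_norm _)
      simp [abs_mul]
    rw [second, norm_mul, norm_div, norm_mul, norm_pow]
    have h3 : ‖(16 : ℂ)‖ * ‖a‖ ^ 2 / ‖2 * a - 1‖ ≤ 32 * (1 + |a.im|) := by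
      rw [div_le_iff₀ (by linarith)]
      have : ‖(16 : ℂ)‖ = 16 := by norm_num
      rw [this]
      calc 16 * ‖a‖ ^ 2 ≤ 16 * (1 + |a.im|) ^ 2 := by gcongr
        _ ≤ 32 * (1 + |a.im|) * (2 * |a.im|) := by nlinarith
        _ ≤ _ := by gcongr
    calc _ ≤ 32 * (1 + |a.im|) * C₂ := by
          have := hs a ha
          gcongr
      _ = _ := by ring
  have hu : ‖gammaFactor a‖ ≤ ‖gammaRatio a‖ ^ 3 / ‖Complex.Gamma (1 / 2)‖ ^ 3 := by
    rw [norm_gammaFactor_eq, div_pow]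
    refine mul_le_of_le_one_left (by positivity) ?_
    exact Real.rpow_le_one_of_one_le_of_nonpos (by norm_num) (by linarith)
  have hcos : |a.im| ≤ ‖Complex.cos (Real.pi * a)‖ := by
    refine le_trans ?_ (abs_im_le_norm_cos _)
    rw [Complex.im_ofReal_mul, abs_mul, abs_of_pos Real.pi_pos]
    exact le_mul_of_one_le_left hpos.le (by linarith [Real.pi_gt_three])
  rw [stripDiff_eq ha hne]
  refine (norm_sub_le _ _).trans (add_le_add ?_ ?_)
  · rw [norm_mul]
    calc ‖gammaFactor a‖ * ‖f a - second a‖ ≤ ‖gammaRatio a‖ ^ 3 / ‖Complex.Gamma (1 / 2)‖ ^ 3 *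
          ((2 * C₁ + 32 * C₂) * (1 + |a.im|)) := by
          gcongr
          refine (norm_sub_le _ _).trans ?_
          linarith
      _ = K * ‖gammaRatio a‖ ^ 3 * (1 + |a.im|) := by ring
      _ ≤ _ := by gcongr; linarith [norm_nonneg (stripNumerator (1 / 2))]
  · rw [norm_div]
    gcongr
    linarith

theorem tendsto_stripDiff_I_mul :
    Tendsto (fun y : ℝ => ‖stripDiff (y * Complex.I)‖) (cocompact ℝ) (𝓝 0) := by
  obtain ⟨C, hC, h⟩ := exists_norm_stripDiff_le
  have hnorm : Tendsto (fun y : ℝ => |y|) (cocompact ℝ) atTop := tendsto_norm_cocompact_atTop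
  -- The cube of `gammaRatio` contributes `t ^ (-3/2)`, which beats the linear growth of `f -
  -- second` by `t ^ (-1/2)`.
  have h1 : Tendsto (fun t : ℝ => 2 * C * (t ^ (-(1 / 2) : ℝ)) + C / t) atTop (𝓝 0) := by
    have := ((tendsto_rpow_neg_atTop (y := 1 / 2) (by norm_num)).const_mul (2 * C)).add
      (tendsto_const_nhds (x := C) |>.div_atTop tendsto_id)
    simpa using this
  refine squeeze_zero' (Eventually.of_forall fun y => norm_nonneg _) ?_ (h1.comp hnorm)
  filter_upwards [hnorm.eventually_ge_atTop 1] with y hy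
  have hpos : 0 < |y| := by linarith
  have h2 := h (y * Complex.I) (by simp) (by simp) (by simpa using hy)
  have h3 : ‖gammaRatio (y * Complex.I)‖ ≤ |y| ^ (-(1 / 2) : ℝ) := by
    have h4 := norm_gammaRatio_I_mul_sq y (abs_pos.1 hpos)
    refine le_of_sq_le_sq ?_ (by positivity)
    rw [← Real.rpow_natCast (|y| ^ (-(1 / 2) : ℝ)), ← Real.rpow_mul hpos.le]
    refine h4.trans_eq ?_
    norm_num
    rw [Real.rpow_neg_one]
  have him : ((y : ℂ) * Complex.I).im = y := by simp
  rw [him] at h2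
  refine h2.trans (add_le_add ?_ le_rfl)
  calc C * ‖gammaRatio (y * Complex.I)‖ ^ 3 * (1 + |y|)
      ≤ C * (|y| ^ (-(1 / 2) : ℝ)) ^ 3 * (2 * |y|) := by gcongr; linarith
    _ = 2 * C * ((|y| ^ (-(1 / 2) : ℝ)) ^ 3 * |y|) := by ring
    _ = _ := by
      congr 1
      rw [← Real.rpow_natCast, ← Real.rpow_mul hpos.le, ← Real.rpow_add_one hpos.ne']
      norm_num

/-- Phragmén–Lindelöf in the strip of width one; antiperiodicity transfers the bound from the left
edge to the right edge. -/
theorem norm_stripDiff_le_of_boundary {M : ℝ} (hM : ∀ y : ℝ, ‖stripDiff (y * Complex.I)‖ ≤ M)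
    {a : ℂ} (h0 : 0 ≤ a.re) (h1 : a.re ≤ 1) : ‖stripDiff a‖ ≤ M := by
  have hline : ∀ z : ℂ, z.re = 0 → ‖stripDiff z‖ ≤ M := fun z hz => by
    have := hM z.im
    rwa [show (z.im : ℂ) * Complex.I = z from Complex.ext (by simp [hz]) (by simp)] at this
  refine PhragmenLindelof.vertical_strip (f := stripDiff) (a := 0) (b := 1) (C := M) ?_ ?_ hline
    ?_ h0 h1
  · refine DifferentiableOn.diffContOnCl (differentiableOn_stripDiff.mono ?_)
    have : closure (Complex.re ⁻¹' Set.Ioo (0 : ℝ) 1) ⊆ Complex.re ⁻¹' Set.Icc 0 1 :=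
      closure_minimal (Set.preimage_mono Set.Ioo_subset_Icc_self)
        (isClosed_Icc.preimage Complex.continuous_re)
    exact this.trans fun z hz => ⟨by linarith [hz.1], by linarith [hz.2]⟩
  · obtain ⟨C, hC, h⟩ := exists_norm_stripDiff_le
    obtain ⟨C', hC', h'⟩ := exists_norm_gammaRatio_le
    refine ⟨1, by linarith [Real.pi_gt_three], 1, ?_⟩
    refine Asymptotics.IsBigO.of_bound (C * C' ^ 3 + C) ?_
    have hev : ∀ᶠ z : ℂ in comap (abs ∘ Complex.im) atTop, 1 ≤ |z.im| :=
      tendsto_comap.eventually_ge_atTop 1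
    filter_upwards [hev.filter_mono inf_le_left, mem_inf_of_right (mem_principal_self _)] with z hz hz'
    refine (h z hz'.1.le hz'.2.le hz).trans ?_
    have h2 := h' z hz'.1.le
    have h3 : 1 + |z.im| ≤ Real.exp (1 * |z.im|) := by
      rw [one_mul, add_comm]
      exact Real.add_one_le_exp _
    have h4 : Real.exp (1 * |z.im|) ≤ Real.exp (1 * Real.exp (1 * |z.im|)) := by
      refine Real.exp_le_exp.2 ?_
      linarith
    rw [Real.norm_of_nonneg (Real.exp_pos _).le, add_mul]
    refine add_le_add ?_ ?_
    · gcongr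
      exact h3.trans h4
    · rw [div_eq_mul_inv]
      gcongr
      refine (inv_le_one_of_one_le₀ hz).trans ?_
      linarith
  · intro z hz
    have h2 : z - 1 ∈ strip := by constructor <;> simp [hz]
    have h3 : z - 1 + 1 ∈ strip := by constructor <;> simp [hz] <;> norm_num
    have h4 := stripDiff_add_one h2 h3
    rw [sub_add_cancel] at h4
    rw [h4, norm_neg]
    exact hline _ (by simp [hz])

theorem stripDiff_eq_zero {a : ℂ} (h0 : 0 ≤ a.re) (h1 : a.re ≤ 1) : stripDiff a = 0 := by
  have hmem : ∀ y : ℝ, (y : ℂ) * Complex.I ∈ strip := fun y => by constructor <;> simp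
  have hcont : Continuous fun y : ℝ => ‖stripDiff (y * Complex.I)‖ := by
    refine continuous_norm.comp (continuous_iff_continuousAt.2 fun y => ?_)
    have : ContinuousAt stripDiff (y * Complex.I) :=
      (differentiableOn_stripDiff.differentiableAt (isOpen_strip.mem_nhds (hmem y))).continuousAt
    exact ContinuousAt.comp (f := fun y : ℝ => (y : ℂ) * Complex.I) this (by fun_prop)
  by_cases hz : ∀ y : ℝ, stripDiff (y * Complex.I) = 0
  · exact norm_le_zero_iff.1 (norm_stripDiff_le_of_boundary (fun y => by simp [hz y]) h0 h1)
  push Not at hz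
  obtain ⟨y₀, hy₀⟩ := hz
  -- Decay at infinity below a nonzero value forces the supremum on the axis to be attained.
  obtain ⟨y, hy⟩ := hcont.exists_forall_ge' y₀
    (tendsto_stripDiff_I_mul.eventually_le_const (norm_pos_iff.2 hy₀))
  have hbound : ∀ {z : ℂ}, 0 ≤ z.re → z.re ≤ 1 → ‖stripDiff z‖ ≤ ‖stripDiff (y * Complex.I)‖ :=
    fun h h' => norm_stripDiff_le_of_boundary hy h h'
  -- The axis is interior to the wider strip, whose outer margins are unit translates of points with
  -- `0 ≤ re ≤ 1`, so the maximum principle applies.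
  have hmax : IsMaxOn (norm ∘ stripDiff) strip (y * Complex.I) := by
    intro z hz
    change ‖stripDiff z‖ ≤ ‖stripDiff (y * Complex.I)‖
    rcases lt_or_ge z.re 0 with hneg | hnonneg
    · have h3 : z + 1 ∈ strip := by
        constructor <;> simp <;> linarith [hz.1]
      rw [← norm_neg (stripDiff z), ← stripDiff_add_one hz h3]
      exact hbound (by simp; linarith [hz.1]) (by simp; linarith)
    rcases le_or_gt z.re 1 with hle | hgt
    · exact hbound hnonneg hle
    · have h3 : z - 1 ∈ strip := by
        constructor <;> simp <;> linarith [hz.2]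
      have h4 := stripDiff_add_one h3 (by simpa using hz)
      rw [sub_add_cancel] at h4
      rw [h4, norm_neg]
      exact hbound (by simp; linarith) (by simp; linarith [hz.2])
  have hconst := Complex.eqOn_of_isPreconnected_of_isMaxOn_norm isPreconnected_strip isOpen_strip
    differentiableOn_stripDiff (hmem y) hmax
  have h2 : (y : ℂ) * Complex.I + 1 ∈ strip := by constructor <;> simp <;> norm_num
  have h3 := hconst h2
  have h4 := stripDiff_add_one (hmem y) h2
  have h5 : stripDiff (y * Complex.I) = 0 := by
    simp only [Function.const_apply] at h3
    rw [h4] at h3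
    linear_combination -h3 / 2
  have h6 := hbound h0 h1
  rw [h5, norm_zero] at h6
  exact norm_le_zero_iff.1 h6

/-! ### Auxiliary real series -/

/-- The quotient `(1)_n / (3/2)_n`. -/
noncomputable def oddWallis (n : ℕ) : ℝ := ∏ i ∈ Finset.range n, (2 * (i : ℝ) + 2) / (2 * i + 3)

/-- The quotient `(1/2)_n / (1)_n`. -/
noncomputable def evenWallis (n : ℕ) : ℝ := ∏ i ∈ Finset.range n, (2 * (i : ℝ) + 1) / (2 * i + 2)

theorem poch_one_div_poch_three_half (n : ℕ) : poch 1 n / poch (3 / 2) n = oddWallis n := by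
  rw [poch, poch, ← Finset.prod_div_distrib, oddWallis]
  push_cast
  refine Finset.prod_congr rfl fun j _ => ?_
  rw [show (2 * (j : ℂ) + 2) = 2 * (1 + j) by ring, show (2 * (j : ℂ) + 3) = 2 * (3 / 2 + j) by ring,
    mul_div_mul_left _ _ two_ne_zero]

theorem poch_half_div_poch_one (n : ℕ) : poch (1 / 2) n / poch 1 n = evenWallis n := by
  rw [poch, poch, ← Finset.prod_div_distrib, evenWallis]
  push_cast
  refine Finset.prod_congr rfl fun j _ => ?_
  rw [show (2 * (j : ℂ) + 2) = 2 * (1 + j) by ring, show (2 * (j : ℂ) + 1) = 2 * (1 / 2 + j) by ring,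
    mul_div_mul_left _ _ two_ne_zero]

theorem poch_half_div_poch_three_half (n : ℕ) :
    poch (1 / 2) n / poch (3 / 2) n = 1 / (2 * n + 1) := by
  have h1 := mul_poch_add_one (1 / 2) n
  rw [show (1 / 2 + 1 : ℂ) = 3 / 2 by norm_num] at h1
  have h2 : poch (3 / 2) n ≠ 0 := poch_ne_zero (fun j h => by
    have := congrArg Complex.re h
    norm_num at this
    linarith [j.cast_nonneg (α := ℝ)]) n
  have h3 : (2 * (n : ℂ) + 1) ≠ 0 := by exact_mod_cast (2 * n).succ_ne_zero
  rw [div_eq_div_iff h2 h3]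
  linear_combination -2 * h1

theorem oddWallis_nonneg (n : ℕ) : 0 ≤ oddWallis n := Finset.prod_nonneg fun i _ => by positivity

theorem evenWallis_nonneg (n : ℕ) : 0 ≤ evenWallis n := Finset.prod_nonneg fun i _ => by positivity

theorem evenWallis_le_one (n : ℕ) : evenWallis n ≤ 1 :=
  Finset.prod_le_one (fun i _ => by positivity) fun i _ =>
    div_le_one_of_le₀ (by linarith) (by positivity)

theorem integral_sin_div_one_add_cos_sq :
    ∫ x in (0 : ℝ)..Real.pi, Real.sin x / (1 + Real.cos x ^ 2) = Real.pi / 2 := by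
  have hd : ∀ x : ℝ, HasDerivAt (fun x => -Real.arctan (Real.cos x))
      (Real.sin x / (1 + Real.cos x ^ 2)) x := fun x => by
    have := ((Real.hasDerivAt_arctan (Real.cos x)).comp x (Real.hasDerivAt_cos x)).neg
    refine this.congr_deriv ?_
    field_simp
  have hc : Continuous fun x : ℝ => Real.sin x / (1 + Real.cos x ^ 2) :=
    Real.continuous_sin.div (by fun_prop) fun x => by positivity
  rw [intervalIntegral.integral_eq_sub_of_hasDerivAt (fun x _ => hd x) (hc.intervalIntegrable _ _)]
  simp
  ring

/-- Wallis: `oddWallis n` is half the integral of `sin ^ (2 n + 1)` over `[0, π]`; the geometric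
series is summed under the integral. -/
theorem hasSum_oddWallis_geometric :
    HasSum (fun n : ℕ => (1 / 2 : ℝ) ^ n * oddWallis n) (Real.pi / 2) := by
  have h : HasSum (fun n : ℕ => ∫ x in (0 : ℝ)..Real.pi,
      1 / 2 * ((1 / 2 : ℝ) ^ n * Real.sin x ^ (2 * n + 1)))
      (∫ x in (0 : ℝ)..Real.pi, Real.sin x / (1 + Real.cos x ^ 2)) := by
    refine intervalIntegral.hasSum_integral_of_dominated_convergence (fun n _ => (1 / 2 : ℝ) ^ n)
      (fun n => by fun_prop) (fun n => ?_) ?_ ?_ ?_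
    · refine Eventually.of_forall fun x _ => ?_
      rw [norm_mul, norm_mul, norm_pow, norm_pow, Real.norm_of_nonneg (by norm_num : (0 : ℝ) ≤ 1 / 2)]
      have h1 : ‖Real.sin x‖ ^ (2 * n + 1) ≤ 1 := pow_le_one₀ (norm_nonneg _) (Real.abs_sin_le_one x)
      have h2 : (0 : ℝ) < (1 / 2) ^ n := by positivity
      nlinarith
    · exact Eventually.of_forall fun x _ =>
        summable_geometric_of_lt_one (by norm_num) (by norm_num)
    · exact intervalIntegrable_const
    · refine Eventually.of_forall fun x _ => ?_
      have h1 : Real.sin x ^ 2 ≤ 1 := Real.sin_sq_le_one x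
      have h2 := (hasSum_geometric_of_lt_one (r := Real.sin x ^ 2 / 2) (by positivity)
        (by linarith)).mul_left (Real.sin x / 2)
      have h3 : Real.sin x / 2 * (1 - Real.sin x ^ 2 / 2)⁻¹ = Real.sin x / (1 + Real.cos x ^ 2) := by
        have h4 : (1 - Real.sin x ^ 2 / 2) = (1 + Real.cos x ^ 2) / 2 := by
          rw [Real.cos_sq']
          ring
        rw [h4]
        field_simp
      rw [h3] at h2
      refine h2.congr_fun fun n => ?_
      rw [pow_succ, pow_mul, show Real.sin x ^ 2 / 2 = 1 / 2 * Real.sin x ^ 2 by ring, mul_pow]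
      ring
  rw [integral_sin_div_one_add_cos_sq] at h
  refine h.congr_fun fun n => ?_
  rw [intervalIntegral.integral_const_mul, intervalIntegral.integral_const_mul, integral_sin_pow_odd,
    oddWallis]
  ring

/-- The binomial series with exponent `-1/2`. -/
theorem hasSum_evenWallis {x : ℝ} (h0 : 0 ≤ x) (h1 : x < 1) :
    HasSum (fun n : ℕ => evenWallis n * x ^ n) (1 / Real.sqrt (1 - x)) := by
  have h := (Complex.one_div_one_sub_cpow_hasFPowerSeriesOnBall_zero (1 / 2)).hasSum
    (y := (x : ℂ)) (by
      rw [← ENNReal.ofReal_one, Metric.eball_ofReal]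
      simpa [abs_of_nonneg h0] using h1)
  rw [← Complex.hasSum_ofReal]
  have e : ((1 / Real.sqrt (1 - x) : ℝ) : ℂ) = 1 / (1 - (0 + (x : ℂ))) ^ (1 / 2 : ℂ) := by
    rw [Real.sqrt_eq_rpow, zero_add]
    push_cast
    rw [Complex.ofReal_cpow (by linarith)]
    push_cast
    rfl
  rw [e]
  refine h.congr_fun fun n => ?_
  have h2 : Ring.choose ((1 / 2 : ℂ) + n - 1) n = evenWallis n := by
    have h3 : ∀ n : ℕ, (ascPochhammer ℕ n).smeval (1 / 2 : ℂ) = poch (1 / 2) n := fun n => by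
      induction n with
      | zero => simp
      | succ n ih =>
        rw [ascPochhammer_succ_right, Polynomial.smeval_mul, ih, poch_succ]
        simp [Polynomial.smeval_add, Polynomial.smeval_natCast]
    have h4 : ∀ n : ℕ, poch 1 n = n.factorial := fun n => by
      induction n with
      | zero => simp
      | succ n ih =>
        rw [poch_succ, ih, Nat.factorial_succ]
        push_cast
        ring
    have h5 := Ring.factorial_nsmul_multichoose_eq_ascPochhammer (1 / 2 : ℂ) n
    rw [h3, nsmul_eq_mul] at h5
    have h6 : (n.factorial : ℂ) ≠ 0 := by exact_mod_cast n.factorial_ne_zero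
    rw [Ring.choose, show (1 / 2 : ℂ) + n - 1 - n + 1 = 1 / 2 by ring, ← poch_half_div_poch_one, h4,
      ← h5, mul_div_cancel_left₀ _ h6]
  rw [FormalMultilinearSeries.ofScalars_apply_eq, h2]
  simp

/-- This is the arcsine series at `1 / √2`: expand `1 = cos x / √(1 - sin² x)` and integrate over
`[0, π / 4]`. -/
theorem hasSum_evenWallis_geometric :
    HasSum (fun n : ℕ => (1 / 2 : ℝ) ^ n * evenWallis n / (2 * n + 1))
      (Real.sqrt 2 * Real.pi / 4) := by
  have hpi := Real.pi_pos
  have hle : (0 : ℝ) ≤ Real.pi / 4 := by positivity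
  have h : HasSum (fun n : ℕ => ∫ x in (0 : ℝ)..Real.pi / 4,
      evenWallis n * (Real.sin x ^ (2 * n) * Real.cos x))
      (∫ x in (0 : ℝ)..Real.pi / 4, (1 : ℝ)) := by
    have hsin : ∀ x ∈ Set.uIoc 0 (Real.pi / 4), Real.sin x ^ 2 ≤ 1 / 2 := fun x hx => by
      rw [Set.uIoc_of_le hle] at hx
      have h1 : Real.sin x ≤ Real.sin (Real.pi / 4) :=
        Real.sin_le_sin_of_le_of_le_pi_div_two (by linarith [hx.1]) (by linarith) hx.2
      have h2 : 0 ≤ Real.sin x := Real.sin_nonneg_of_nonneg_of_le_pi hx.1.le (by linarith [hx.2])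
      calc Real.sin x ^ 2 ≤ Real.sin (Real.pi / 4) ^ 2 := by gcongr
        _ = 1 / 2 := by
          rw [Real.sin_pi_div_four, div_pow, Real.sq_sqrt zero_le_two]
          norm_num
    refine intervalIntegral.hasSum_integral_of_dominated_convergence (fun n _ => (1 / 2 : ℝ) ^ n)
      (fun n => by fun_prop) (fun n => ?_) ?_ ?_ ?_
    · refine Eventually.of_forall fun x hx => ?_
      rw [norm_mul, norm_mul, Real.norm_of_nonneg (evenWallis_nonneg n), pow_mul, norm_pow,
        Real.norm_of_nonneg (sq_nonneg _)]
      have h1 : (Real.sin x ^ 2) ^ n ≤ (1 / 2) ^ n := pow_le_pow_left₀ (sq_nonneg _) (hsin x hx) n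
      calc evenWallis n * ((Real.sin x ^ 2) ^ n * ‖Real.cos x‖) ≤ 1 * ((1 / 2) ^ n * 1) := by
            gcongr
            · exact evenWallis_le_one n
            · exact Real.abs_cos_le_one x
        _ = _ := by ring
    · exact Eventually.of_forall fun x _ =>
        summable_geometric_of_lt_one (by norm_num) (by norm_num)
    · exact intervalIntegrable_const
    · refine Eventually.of_forall fun x hx => ?_
      have h1 := hsin x hx
      have h2 := (hasSum_evenWallis (sq_nonneg (Real.sin x)) (by linarith)).mul_right (Real.cos x)
      rw [Set.uIoc_of_le hle] at hx
      have h3 : 0 < Real.cos x := Real.cos_pos_of_mem_Ioo ⟨by linarith [hx.1], by linarith [hx.2]⟩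
      rw [← Real.cos_sq', Real.sqrt_sq h3.le, one_div_mul_cancel h3.ne'] at h2
      refine h2.congr_fun fun n => ?_
      rw [pow_mul]
      ring
  have h2 := h.mul_left (Real.sqrt 2)
  rw [intervalIntegral.integral_const, sub_zero, smul_eq_mul, mul_one, mul_div_assoc'] at h2
  refine h2.congr_fun fun n => ?_
  have h3 := integral_sin_pow_mul_cos_pow_odd (a := 0) (b := Real.pi / 4) (2 * n) 0
  simp only [mul_zero, zero_add, pow_one, pow_zero, mul_one] at h3
  rw [intervalIntegral.integral_const_mul, h3, integral_pow, Real.sin_zero, Real.sin_pi_div_four]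
  have h4 : Real.sqrt 2 * Real.sqrt 2 = 2 := Real.mul_self_sqrt zero_le_two
  have h5 : (Real.sqrt 2 / 2) ^ 2 = 1 / 2 := by
    rw [div_pow, Real.sq_sqrt zero_le_two]
    norm_num
  rw [zero_pow (by omega), sub_zero, pow_succ, pow_mul, h5]
  push_cast
  linear_combination (-(1 / 2 : ℝ) ^ n * evenWallis n / (2 * n + 1) / 2) * h4

/-! ### A series for Catalan's constant -/

theorem sinc_ne_zero_of_mem {x : ℝ} (hx : x ∈ Set.uIcc 0 (Real.pi / 2)) : Real.sinc x ≠ 0 := by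
  rw [Set.uIcc_of_le (by positivity)] at hx
  rcases hx.1.eq_or_lt with rfl | h
  · simp
  · rw [Real.sinc_of_ne_zero h.ne']
    exact div_ne_zero (Real.sin_pos_of_pos_of_lt_pi h (by linarith [hx.2, Real.pi_pos])).ne' h.ne'

theorem inv_sinc_mul_sin {x : ℝ} (hx : x ∈ Set.uIcc 0 (Real.pi / 2)) :
    (Real.sinc x)⁻¹ * Real.sin x = x := by
  rw [inv_mul_eq_iff_eq_mul₀ (sinc_ne_zero_of_mem hx)]
  by_cases h : x = 0
  · simp [h]
  · rw [Real.sinc_of_ne_zero h, div_mul_cancel₀ _ h]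

theorem continuousOn_inv_sinc : ContinuousOn (fun x => (Real.sinc x)⁻¹) (Set.uIcc 0 (Real.pi / 2)) :=
  Real.continuous_sinc.continuousOn.inv₀ fun _ hx => sinc_ne_zero_of_mem hx

theorem intervalIntegrable_inv_sinc_mul {g : ℝ → ℝ} (hg : Continuous g) :
    IntervalIntegrable (fun x => (Real.sinc x)⁻¹ * g x) MeasureTheory.volume 0 (Real.pi / 2) :=
  (continuousOn_inv_sinc.mul hg.continuousOn).intervalIntegrable

/-- `(Real.sinc x)⁻¹` is `x / sin x` made regular at `0`; a factor `sin x` in the difference cancels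
the denominator. -/
theorem integral_inv_sinc_mul_sub {g₁ g₂ : ℝ → ℝ} (h₁ : Continuous g₁) (h₂ : Continuous g₂)
    {h : ℝ → ℝ} (hh : ∀ x, g₁ x - g₂ x = Real.sin x * h x) :
    (∫ x in (0 : ℝ)..Real.pi / 2, (Real.sinc x)⁻¹ * g₁ x) -
      ∫ x in (0 : ℝ)..Real.pi / 2, (Real.sinc x)⁻¹ * g₂ x =
      ∫ x in (0 : ℝ)..Real.pi / 2, x * h x := by
  rw [← intervalIntegral.integral_sub (intervalIntegrable_inv_sinc_mul h₁)
    (intervalIntegrable_inv_sinc_mul h₂)]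
  refine intervalIntegral.integral_congr fun x hx => ?_
  change (Real.sinc x)⁻¹ * g₁ x - (Real.sinc x)⁻¹ * g₂ x = x * h x
  rw [← mul_sub, hh, ← mul_assoc, inv_sinc_mul_sin hx]

theorem integral_mul_sin_mul_cos_pow (n : ℕ) :
    ∫ x in (0 : ℝ)..Real.pi / 2, x * (Real.sin x * Real.cos x ^ (2 * n)) =
      oddWallis n / (2 * n + 1) := by
  have h0 : (2 * (n : ℝ) + 1) ≠ 0 := by positivity
  have hv : ∀ x : ℝ, HasDerivAt (fun x => -(Real.cos x ^ (2 * n + 1) / (2 * n + 1)))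
      (Real.sin x * Real.cos x ^ (2 * n)) x := fun x => by
    refine (((Real.hasDerivAt_cos x).pow (2 * n + 1)).div_const (2 * n + 1 : ℝ)).neg.congr_deriv ?_
    push_cast
    field_simp
  rw [intervalIntegral.integral_mul_deriv_eq_deriv_mul (u := fun x => x) (fun x _ => hasDerivAt_id' x)
    (fun x _ => hv x) intervalIntegrable_const
    (Continuous.intervalIntegrable (by fun_prop) _ _)]
  simp only [one_mul, Real.cos_pi_div_two, intervalIntegral.integral_neg,
    intervalIntegral.integral_div, EulerSine.integral_cos_pow_eq, integral_sin_pow_odd]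
  rw [zero_pow (by omega), oddWallis]
  ring

theorem integral_mul_two_sin (n : ℕ) :
    ∫ x in (0 : ℝ)..Real.pi / 2, x * (2 * Real.sin ((2 * n + 1) * x)) =
      2 * ((-1) ^ n / (2 * n + 1) ^ 2) := by
  have h0 : (2 * (n : ℝ) + 1) ≠ 0 := by positivity
  have hd : ∀ x : ℝ, HasDerivAt (fun x => 2 * (Real.sin ((2 * n + 1) * x) / (2 * n + 1) ^ 2 -
      x * (Real.cos ((2 * n + 1) * x) / (2 * n + 1)))) (x * (2 * Real.sin ((2 * n + 1) * x))) x := by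
    intro x
    have h1 : HasDerivAt (fun x : ℝ => (2 * (n : ℝ) + 1) * x) (2 * n + 1) x := by
      simpa using (hasDerivAt_id x).const_mul (2 * (n : ℝ) + 1)
    refine (((h1.sin.div_const ((2 * n + 1 : ℝ) ^ 2)).sub
      ((hasDerivAt_id x).mul (h1.cos.div_const (2 * n + 1 : ℝ)))).const_mul 2).congr_deriv ?_
    simp only [id]
    field_simp
    ring
  rw [intervalIntegral.integral_eq_sub_of_hasDerivAt (fun x _ => hd x)
    (Continuous.intervalIntegrable (by fun_prop) _ _)]
  have e : (2 * (n : ℝ) + 1) * (Real.pi / 2) = Real.pi / 2 + n * Real.pi := by ring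
  rw [e, Real.sin_add_nat_mul_pi, Real.cos_add_nat_mul_pi]
  simp

theorem tendsto_integral_inv_sinc_mul_cos_pow :
    Tendsto (fun n : ℕ => ∫ x in (0 : ℝ)..Real.pi / 2, (Real.sinc x)⁻¹ * Real.cos x ^ (2 * n))
      atTop (𝓝 0) := by
  suffices h : Tendsto (fun n : ℕ => ∫ x in (0 : ℝ)..Real.pi / 2,
      (Real.sinc x)⁻¹ * Real.cos x ^ (2 * n)) atTop (𝓝 (∫ x in (0 : ℝ)..Real.pi / 2, (0 : ℝ))) by
    rwa [intervalIntegral.integral_zero] at h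
  refine intervalIntegral.tendsto_integral_filter_of_dominated_convergence
    (fun x => ‖(Real.sinc x)⁻¹‖) (Eventually.of_forall fun n => ?_)
    (Eventually.of_forall fun n => Eventually.of_forall fun x _ => ?_)
    (ContinuousOn.intervalIntegrable continuousOn_inv_sinc.norm) (Eventually.of_forall fun x hx => ?_)
  · exact (intervalIntegrable_inv_sinc_mul (by fun_prop)).aestronglyMeasurable_restrict_uIoc
  · rw [norm_mul, norm_pow]
    exact mul_le_of_le_one_right (norm_nonneg _)
      (pow_le_one₀ (norm_nonneg _) (Real.abs_cos_le_one x))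
  · rw [Set.uIoc_of_le (by positivity)] at hx
    have hs := Real.sin_pos_of_pos_of_lt_pi hx.1 (by linarith [hx.2, Real.pi_pos])
    have h1 : Real.cos x ^ 2 < 1 := by
      rw [Real.cos_sq']
      nlinarith
    have h2 := (tendsto_pow_atTop_nhds_zero_of_lt_one (sq_nonneg (Real.cos x)) h1).const_mul
      (Real.sinc x)⁻¹
    simpa only [mul_zero, ← pow_mul] using h2

theorem tendsto_integral_inv_sinc_mul_cos_mul :
    Tendsto (fun n : ℕ => ∫ x in (0 : ℝ)..Real.pi / 2, (Real.sinc x)⁻¹ * Real.cos (2 * n * x))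
      atTop (𝓝 0) := by
  set g : ℝ → ℂ := (Set.Ioc 0 (Real.pi / 2)).indicator fun x => (((Real.sinc x)⁻¹ : ℝ) : ℂ)
  -- Riemann–Lebesgue; frequency `n / π` in the kernel `exp (-2 π i v w)` produces `cos (2 n v)`.
  have hw : Tendsto (fun n : ℕ => (n : ℝ) / Real.pi) atTop (cocompact ℝ) :=
    (tendsto_natCast_atTop_atTop.atTop_div_const Real.pi_pos).mono_right atTop_le_cocompact
  have h1 := (Complex.continuous_re.tendsto 0).comp
    ((Real.tendsto_integral_exp_smul_cocompact g).comp hw)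
  rw [Complex.zero_re] at h1
  refine h1.congr fun n => ?_
  simp only [Function.comp_apply]
  have h2 : ∀ v : ℝ, Real.fourierChar (-(v * (n / Real.pi))) • g v =
      (Set.Ioc 0 (Real.pi / 2)).indicator
        (fun v => Complex.exp (((-2 * n * v : ℝ) : ℂ) * Complex.I) * (((Real.sinc v)⁻¹ : ℝ) : ℂ)) v := by
    intro v
    rw [Circle.smul_def, Real.fourierChar_apply, smul_eq_mul]
    by_cases hv : v ∈ Set.Ioc 0 (Real.pi / 2)
    · simp only [g, Set.indicator_of_mem hv]
      congr 4
      have := Real.pi_ne_zero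
      field_simp
    · simp only [g, Set.indicator_of_notMem hv, mul_zero]
  simp only [h2]
  rw [MeasureTheory.integral_indicator measurableSet_Ioc,
    ← intervalIntegral.integral_of_le (by positivity)]
  have hint : IntervalIntegrable (fun v : ℝ => Complex.exp (((-2 * n * v : ℝ) : ℂ) * Complex.I) *
      (((Real.sinc v)⁻¹ : ℝ) : ℂ)) MeasureTheory.volume 0 (Real.pi / 2) := by
    refine ContinuousOn.intervalIntegrable (ContinuousOn.mul (by fun_prop) ?_)
    exact Complex.continuous_ofReal.comp_continuousOn continuousOn_inv_sinc
  have h3 := Complex.reCLM.intervalIntegral_comp_comm hint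
  simp only [Complex.reCLM_apply] at h3
  rw [← h3]
  refine intervalIntegral.integral_congr fun v _ => ?_
  rw [Complex.re_mul_ofReal, Complex.exp_ofReal_mul_I_re, mul_comm]
  congr 1
  rw [← Real.cos_neg]
  ring_nf

/-- `J = ∫ x / sin x` over `[0, π / 2]` is telescoped once through the weights `cos ^ (2 n)` and
once through `cos (2 n x)`. Both start at the weight `1` and have integrals tending to zero; the
increments give the two series. -/
theorem hasSum_oddWallis_div :
    HasSum (fun n : ℕ => oddWallis n / (2 * n + 1)) (2 * catalanConstant) := by
  set J := ∫ x in (0 : ℝ)..Real.pi / 2, (Real.sinc x)⁻¹ * 1 with hJ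
  have h1 : HasSum (fun n : ℕ => oddWallis n / (2 * n + 1)) J := by
    rw [hasSum_iff_tendsto_nat_of_nonneg
      fun n => div_nonneg (oddWallis_nonneg n) (by positivity)]
    have h := tendsto_integral_inv_sinc_mul_cos_pow.const_sub J
    rw [sub_zero] at h
    refine h.congr fun n => ?_
    induction n with
    | zero => simp [hJ]
    | succ n ih =>
      rw [Finset.sum_range_succ, ← ih, ← integral_mul_sin_mul_cos_pow,
        ← integral_inv_sinc_mul_sub (g₁ := fun x => Real.cos x ^ (2 * n))
          (g₂ := fun x => Real.cos x ^ (2 * (n + 1))) (by fun_prop) (by fun_prop)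
          (h := fun x => Real.sin x * Real.cos x ^ (2 * n))]
      · ring
      · intro x
        rw [mul_add, pow_add, mul_one, Real.cos_sq']
        ring
  have hs : Summable fun n : ℕ => (-1) ^ n / (2 * (n : ℝ) + 1) ^ 2 := by
    refine Summable.of_norm_bounded ((summable_nat_add_iff 1).2
      (Real.summable_one_div_nat_pow.2 one_lt_two)) fun n => ?_
    rw [norm_div, norm_pow, norm_neg, norm_one, one_pow, Real.norm_of_nonneg (by positivity)]
    push_cast
    gcongr
    linarith [n.cast_nonneg (α := ℝ)]
  have h2 : Tendsto (fun n => ∑ i ∈ Finset.range n, 2 * ((-1) ^ i / (2 * (i : ℝ) + 1) ^ 2)) atTop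
      (𝓝 J) := by
    have h := tendsto_integral_inv_sinc_mul_cos_mul.const_sub J
    rw [sub_zero] at h
    refine h.congr fun n => ?_
    induction n with
    | zero => simp [hJ]
    | succ n ih =>
      rw [Finset.sum_range_succ, ← ih, ← integral_mul_two_sin,
        ← integral_inv_sinc_mul_sub (g₁ := fun x => Real.cos (2 * n * x))
          (g₂ := fun x => Real.cos (2 * (n + 1 : ℕ) * x)) (by fun_prop) (by fun_prop)
          (h := fun x => 2 * Real.sin ((2 * n + 1) * x))]
      · ring
      · intro x
        rw [Real.cos_sub_cos]
        push_cast
        rw [show (2 * (n : ℝ) * x + 2 * (n + 1) * x) / 2 = (2 * n + 1) * x by ring,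
          show (2 * (n : ℝ) * x - 2 * (n + 1) * x) / 2 = -x by ring, Real.sin_neg]
        ring
  have h3 : J = 2 * catalanConstant :=
    tendsto_nhds_unique h2 (hs.hasSum.mul_left 2).tendsto_sum_nat
  rw [← h3]
  exact h1

/-! ### The second identity -/

theorem tsum_secondTerm_half : ∑' n, secondTerm (1 / 2) n = Real.pi / 2 := by
  have h := Complex.hasSum_ofReal.2 hasSum_oddWallis_geometric
  have e : ((Real.pi / 2 : ℝ) : ℂ) = Real.pi / 2 := by push_cast; rfl
  rw [← e, ← h.tsum_eq]
  refine tsum_congr fun n => ?_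
  have h1 : poch 1 n ≠ 0 := poch_ne_zero (fun j => by
    rw [add_comm]
    exact_mod_cast j.succ_ne_zero) n
  rw [secondTerm, show (1 / 2 + 1 / 2 : ℂ) = 1 by norm_num, show (1 / 2 + 1 : ℂ) = 3 / 2 by norm_num,
    show (3 / 2 - 1 / 2 : ℂ) = 1 by norm_num, pow_two, mul_div_mul_right _ _ h1,
    poch_one_div_poch_three_half]
  push_cast
  rw [one_div_pow]

theorem Gamma_half_sq : Complex.Gamma (1 / 2) ^ 2 = Real.pi := by
  have h1 : (1 / 2 : ℂ) = ((1 / 2 : ℝ) : ℂ) := by push_cast; rfl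
  rw [h1, Complex.Gamma_ofReal, Real.Gamma_one_half_eq, ← Complex.ofReal_pow,
    Real.sq_sqrt Real.pi_pos.le]

theorem eight_cpow_neg_half : (8 : ℂ) ^ (-(1 / 2) : ℂ) = Real.sqrt 2 / 4 := by
  have h1 : (8 : ℂ) ^ (-(1 / 2) : ℂ) = (((8 : ℝ) ^ (-(1 / 2) : ℝ) : ℝ) : ℂ) := by
    rw [Complex.ofReal_cpow (by norm_num)]
    push_cast
    rfl
  have h2 : (8 : ℝ) ^ (-(1 / 2) : ℝ) = Real.sqrt 2 / 4 := by
    have h3 : Real.sqrt 8 = 2 * Real.sqrt 2 := by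
      rw [show (8 : ℝ) = 2 ^ 2 * 2 by norm_num, Real.sqrt_mul (by norm_num), Real.sqrt_sq zero_le_two]
    rw [Real.rpow_neg (by norm_num), ← Real.sqrt_eq_rpow, h3]
    have h4 := Real.sq_sqrt zero_le_two
    have h5 : Real.sqrt 2 ≠ 0 := by positivity
    field_simp
    linarith
  rw [h1, h2]
  push_cast
  rfl

/-- The term with `f` drops out because the cosine vanishes, so the constant of the second identity
comes from the series at `1 / 2` alone. -/
theorem stripNumerator_half : stripNumerator (1 / 2) = 2 * Real.sqrt 2 / Real.pi := by
  have hpi : (Real.pi : ℂ) ≠ 0 := by exact_mod_cast Real.pi_ne_zero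
  have hG : Complex.Gamma (1 / 2) ≠ 0 := Complex.Gamma_ne_zero_of_re_pos (by norm_num)
  have h1 : gammaRatio (1 / 2) = 2 / Complex.Gamma (1 / 2) := by
    rw [gammaRatio, show (1 / 2 + 1 / 2 : ℂ) = 1 by norm_num, Complex.Gamma_one,
      Complex.Gamma_add_one _ (by norm_num)]
    field_simp
  rw [stripNumerator, cos_pi_half, cosQuot_half, tsum_secondTerm_half, gammaFactor, h1,
    eight_cpow_neg_half, div_div, ← pow_two, Gamma_half_sq]
  field_simp
  ring

/-- The explicit term of the second identity. -/
noncomputable def explicitTerm (a : ℂ) : ℂ :=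
  2 * Real.sqrt 2 / Real.pi * ((8 : ℂ) ^ a / Complex.cos (Real.pi * a)) *
    (cpoch 1 a ^ 3 / cpoch (1 / 2) a ^ 3)

theorem explicitTerm_eq (a : ℂ) : explicitTerm a = 2 * Real.sqrt 2 / Real.pi *
    ((8 : ℂ) ^ a / Complex.cos (Real.pi * a)) * (Complex.Gamma (1 / 2) / gammaRatio a) ^ 3 := by
  rw [explicitTerm, ← div_pow, cpoch, cpoch, gammaRatio, Complex.Gamma_one, div_one, div_div_eq_mul_div,
    div_div_eq_mul_div, add_comm 1 a, add_comm (1 / 2) a, mul_comm (Complex.Gamma (a + 1))]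

theorem explicitTerm_recurrence {a : ℂ} (ha : Admissible a) (hh : NotHalfInteger a) :
    explicitTerm a = recFactor a * explicitTerm (a + 1) := by
  have h1 := ha.one_ne_zero
  have h2 := hh.half_add_ne_zero
  have h3 : recFactor a * 8 * ((a + 1) / (a + 1 / 2)) ^ 3 = -1 := by
    rw [recFactor]
    generalize a + 1 / 2 = w at *
    field_simp
  rw [explicitTerm_eq, explicitTerm_eq, gammaRatio_add_one ha h2, mul_add, mul_one,
    Complex.cos_add_pi, Complex.cpow_add _ _ (by norm_num), Complex.cpow_one]
  have h4 : (Complex.Gamma (1 / 2) / (gammaRatio a * ((a + 1 / 2) / (a + 1)))) ^ 3 =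
      (Complex.Gamma (1 / 2) / gammaRatio a) ^ 3 * ((a + 1) / (a + 1 / 2)) ^ 3 := by
    rw [← mul_pow, ← div_div, div_div_eq_mul_div, mul_div_assoc]
  rw [h4]
  linear_combination (2 * Real.sqrt 2 / Real.pi *
    ((8 : ℂ) ^ a / Complex.cos (Real.pi * a)) * (Complex.Gamma (1 / 2) / gammaRatio a) ^ 3) * h3

theorem gammaFactor_mul_explicitTerm {a : ℂ} (ha : -(1 / 4) < a.re) :
    gammaFactor a * explicitTerm a =
      2 * Real.sqrt 2 / Real.pi / Complex.cos (Real.pi * a) := by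
  have h1 := gammaFactor_ne_zero ha
  rw [gammaFactor] at h1
  have h2 : (8 : ℂ) ^ (-a) * (8 : ℂ) ^ a = 1 := by
    rw [← Complex.cpow_add _ _ (by norm_num), neg_add_cancel, Complex.cpow_zero]
  have h3 : gammaRatio a / Complex.Gamma (1 / 2) ≠ 0 := fun h => h1 (by rw [h]; simp)
  have h4 : (gammaRatio a / Complex.Gamma (1 / 2)) ^ 3 *
      (Complex.Gamma (1 / 2) / gammaRatio a) ^ 3 = 1 := by
    rw [← mul_pow, ← inv_div (gammaRatio a), mul_inv_cancel₀ h3, one_pow]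
  rw [explicitTerm_eq, gammaFactor]
  calc _ = (8 : ℂ) ^ (-a) * (8 : ℂ) ^ a * ((gammaRatio a / Complex.Gamma (1 / 2)) ^ 3 *
        (Complex.Gamma (1 / 2) / gammaRatio a) ^ 3) *
        (2 * Real.sqrt 2 / Real.pi / Complex.cos (Real.pi * a)) := by ring
    _ = _ := by rw [h2, h4, one_mul, one_mul]

theorem f_eq_second_of_mem {a : ℂ} (h0 : 0 ≤ a.re) (h1 : a.re ≤ 1) (hh : NotHalfInteger a) :
    f a = explicitTerm a + second a := by
  have hne : a ≠ 1 / 2 := by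
    rintro rfl
    exact hh 0 (by simp)
  have hre : -(1 / 4) < a.re := by linarith
  have h := stripDiff_eq (a := a) ⟨hre, by linarith⟩ hne
  rw [stripDiff_eq_zero h0 h1, stripNumerator_half, ← gammaFactor_mul_explicitTerm hre] at h
  have h2 : gammaFactor a * (f a - second a - explicitTerm a) = 0 := by linear_combination -h
  rcases mul_eq_zero.1 h2 with h3 | h3
  · exact absurd h3 (gammaFactor_ne_zero hre)
  · linear_combination h3

theorem f_eq_second_iff_add_one {a : ℂ} (ha : Admissible a) (hh : NotHalfInteger a) :
    f a = explicitTerm a + second a ↔ f (a + 1) = explicitTerm (a + 1) + second (a + 1) := by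
  have h0 : recFactor a ≠ 0 :=
    mul_ne_zero (by norm_num) (pow_ne_zero 3 (div_ne_zero hh.half_add_ne_zero ha.one_ne_zero))
  rw [f_recurrence a, second_recurrence ha hh, explicitTerm_recurrence ha hh]
  refine ⟨fun h => mul_left_cancel₀ h0 ?_, fun h => ?_⟩
  · linear_combination h
  · linear_combination recFactor a * h

/-- Since `recFactor` does not vanish here, the identity passes between `a` and `a + 1` in both
directions, starting from `0 ≤ re a ≤ 1`. -/
theorem f_eq_second {a : ℂ} (ha : Admissible a) (hh : NotHalfInteger a) :
    f a = explicitTerm a + second a := by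
  have hup : ∀ (n : ℕ) (b : ℂ), 0 ≤ b.re → b.re ≤ 1 → NotHalfInteger b →
      f (b + n) = explicitTerm (b + n) + second (b + n) := fun n b h0 h1 hb => by
    induction n with
    | zero => simpa using f_eq_second_of_mem h0 h1 hb
    | succ n ih =>
      have h := (f_eq_second_iff_add_one ((admissible_of_re (by linarith)).add_nat n)
        (hb.add_int n)).1 (by simpa using ih)
      simpa [add_assoc] using h
  have hdown : ∀ (n : ℕ) (b : ℂ), 0 ≤ (b + n).re → (b + n).re ≤ 1 → NotHalfInteger b →
      Admissible b → f b = explicitTerm b + second b := fun n => by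
    induction n with
    | zero =>
      intro b h0 h1 hb _
      exact f_eq_second_of_mem (by simpa using h0) (by simpa using h1) hb
    | succ n ih =>
      intro b h0 h1 hb hA
      refine (f_eq_second_iff_add_one hA hb).2 (ih (b + 1) ?_ ?_ hb.add_one hA.add_one)
      · convert h0 using 1
        simp
        ring
      · convert h1 using 1
        simp
        ring
  rcases le_total 0 a.re with h | h
  · have hf := Nat.floor_le h
    have hl := Nat.lt_floor_add_one a.re
    have := hup ⌊a.re⌋₊ (a - ⌊a.re⌋₊) (by simpa using hf) (by simp; linarith)
      (by simpa [sub_eq_add_neg] using hh.add_int (-(⌊a.re⌋₊ : ℤ)))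
    simpa using this
  · have hf := Nat.le_ceil (-a.re)
    have hl := Nat.ceil_lt_add_one (neg_nonneg.2 h)
    exact hdown ⌈-a.re⌉₊ a (by simp; linarith) (by simp; linarith) hh ha

/-! ### Values at `1 / 2` and at `0` -/

theorem f_half : f (1 / 2) = 4 * (catalanConstant : ℂ) := by
  have hre : (0 : ℝ) < (1 / 2 : ℂ).re := by norm_num
  rw [f_eq_first (admissible_of_re (by linarith)) (summable_firstTerm hre)]
  have h := (Complex.hasSum_ofReal.2 hasSum_oddWallis_div).tsum_eq
  have e : ∑' n, firstTerm (1 / 2) n = ∑' n : ℕ, ((oddWallis n / (2 * n + 1) : ℝ) : ℂ) := by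
    refine tsum_congr fun n => ?_
    rw [firstTerm, show (1 / 2 / 2 + 1 / 4 : ℂ) = 1 / 2 by norm_num,
      show (1 / 2 / 2 + 3 / 4 : ℂ) = 1 by norm_num, show (1 / 2 + 1 : ℂ) = 3 / 2 by norm_num, pow_two,
      mul_div_mul_comm, poch_half_div_poch_three_half, poch_one_div_poch_three_half]
    push_cast
    ring
  rw [e, h]
  push_cast
  ring

theorem notHalfInteger_zero : NotHalfInteger 0 := by
  rw [notHalfInteger_iff]
  simp

theorem explicitTerm_zero : explicitTerm 0 = 2 * Real.sqrt 2 / Real.pi := by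
  have hG : Complex.Gamma (1 / 2) ≠ 0 := Complex.Gamma_ne_zero_of_re_pos (by norm_num)
  simp only [explicitTerm, cpoch, add_zero, div_self hG]
  simp

theorem f_zero : f 0 = 2 * Real.sqrt 2 / Real.pi := by
  rw [f_eq_second (admissible_of_re (by simp)) notHalfInteger_zero, explicitTerm_zero]
  simp [second]

theorem analyticAt_f : AnalyticAt ℂ f 0 :=
  differentiableOn_f.analyticAt
    ((isOpen_lt continuous_const Complex.continuous_re).mem_nhds (by simp))

theorem tsum_secondTerm_zero : ∑' n, secondTerm 0 n = Real.sqrt 2 * Real.pi / 4 := by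
  have h := (Complex.hasSum_ofReal.2 hasSum_evenWallis_geometric).tsum_eq
  have e : ∑' n, secondTerm 0 n =
      ∑' n : ℕ, (((1 / 2 : ℝ) ^ n * evenWallis n / (2 * n + 1) : ℝ) : ℂ) := by
    refine tsum_congr fun n => ?_
    rw [secondTerm, zero_add, zero_add, sub_zero, pow_two, mul_div_mul_comm,
      poch_half_div_poch_three_half, poch_half_div_poch_one]
    push_cast
    rw [one_div_pow]
    ring
  rw [e, h]
  push_cast
  rfl

/-! ### Second-order expansions at the origin -/

/-- The function `g` has the expansion `c₀ + c₁ a + c₂ a² + O(a³)` at `0`, with an analytic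
remainder. -/
def HasJet (g : ℂ → ℂ) (c₀ c₁ c₂ : ℂ) : Prop :=
  ∃ r : ℂ → ℂ, AnalyticAt ℂ r 0 ∧ ∀ᶠ a in 𝓝 0, g a = c₀ + c₁ * a + c₂ * a ^ 2 + a ^ 3 * r a

theorem exists_analyticAt_eq_add_mul {g : ℂ → ℂ} (hg : AnalyticAt ℂ g 0) :
    ∃ r : ℂ → ℂ, AnalyticAt ℂ r 0 ∧ ∀ a, g a = g 0 + a * r a := by
  obtain ⟨p, hp⟩ := hg
  refine ⟨dslope g 0, hp.has_fpower_series_dslope_fslope.analyticAt, fun a => ?_⟩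
  have := sub_smul_dslope g 0 a
  rw [sub_zero, smul_eq_mul] at this
  rw [this]
  ring

theorem exists_hasJet {g : ℂ → ℂ} (hg : AnalyticAt ℂ g 0) : ∃ c₁ c₂, HasJet g (g 0) c₁ c₂ := by
  obtain ⟨r, hr, h1⟩ := exists_analyticAt_eq_add_mul hg
  obtain ⟨s, hs, h2⟩ := exists_analyticAt_eq_add_mul hr
  obtain ⟨t, ht, h3⟩ := exists_analyticAt_eq_add_mul hs
  refine ⟨r 0, s 0, t, ht, Eventually.of_forall fun a => ?_⟩
  rw [h1, h2, h3]
  ring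

namespace HasJet

variable {g h : ℂ → ℂ} {c₀ c₁ c₂ d₀ d₁ d₂ : ℂ}

theorem congr (hg : HasJet g c₀ c₁ c₂) (e : ∀ᶠ a in 𝓝 0, g a = h a) : HasJet h c₀ c₁ c₂ := by
  obtain ⟨r, hr, h1⟩ := hg
  exact ⟨r, hr, by filter_upwards [h1, e] with a ha ha' using ha' ▸ ha⟩

theorem mul (hg : HasJet g c₀ c₁ c₂) (hh : HasJet h d₀ d₁ d₂) :
    HasJet (fun a => g a * h a) (c₀ * d₀) (c₀ * d₁ + c₁ * d₀) (c₀ * d₂ + c₁ * d₁ + c₂ * d₀) := by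
  obtain ⟨r, hr, h1⟩ := hg
  obtain ⟨s, hs, h2⟩ := hh
  refine ⟨fun a => c₁ * d₂ + c₂ * d₁ + a * (c₂ * d₂) + r a * (d₀ + d₁ * a + d₂ * a ^ 2) +
    s a * (c₀ + c₁ * a + c₂ * a ^ 2) + a ^ 3 * (r a * s a), by fun_prop, ?_⟩
  filter_upwards [h1, h2] with a ha ha'
  rw [ha, ha']
  ring

theorem add (hg : HasJet g c₀ c₁ c₂) (hh : HasJet h d₀ d₁ d₂) :
    HasJet (fun a => g a + h a) (c₀ + d₀) (c₁ + d₁) (c₂ + d₂) := by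
  obtain ⟨r, hr, h1⟩ := hg
  obtain ⟨s, hs, h2⟩ := hh
  refine ⟨fun a => r a + s a, by fun_prop, ?_⟩
  filter_upwards [h1, h2] with a ha ha'
  rw [ha, ha']
  ring

theorem const (c : ℂ) : HasJet (fun _ => c) c 0 0 :=
  ⟨fun _ => 0, analyticAt_const, Eventually.of_forall fun a => by ring⟩

theorem id : HasJet (fun a => a) 0 1 0 :=
  ⟨fun _ => 0, analyticAt_const, Eventually.of_forall fun a => by ring⟩

theorem comp_mul (hg : HasJet g c₀ c₁ c₂) (k : ℂ) :
    HasJet (fun a => g (k * a)) c₀ (k * c₁) (k ^ 2 * c₂) := by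
  obtain ⟨r, hr, h1⟩ := hg
  have ht : Tendsto (fun a : ℂ => k * a) (𝓝 0) (𝓝 0) := by
    have : Continuous fun a : ℂ => k * a := by fun_prop
    simpa using this.tendsto 0
  have hr' : AnalyticAt ℂ (fun a => r (k * a)) 0 :=
    AnalyticAt.fun_comp (g := r) (f := fun a : ℂ => k * a) (by simpa using hr) (by fun_prop)
  refine ⟨fun a => k ^ 3 * r (k * a), analyticAt_const.mul hr', ?_⟩
  filter_upwards [ht.eventually h1] with a ha
  rw [ha]
  ring

theorem apply_zero (hg : HasJet g c₀ c₁ c₂) : g 0 = c₀ := by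
  obtain ⟨r, -, h1⟩ := hg
  simpa using h1.self_of_nhds

theorem eventually_deriv (hg : HasJet g c₀ c₁ c₂) : ∃ r : ℂ → ℂ, AnalyticAt ℂ r 0 ∧
    ∀ᶠ a in 𝓝 0, deriv g a = c₁ + 2 * c₂ * a + a ^ 2 * r a := by
  obtain ⟨r, hr, h1⟩ := hg
  have hr' := hr.deriv
  refine ⟨fun a => 3 * r a + a * deriv r a, by fun_prop, ?_⟩
  filter_upwards [h1.eventually_nhds, hr.eventually_analyticAt] with a ha hra
  have h2 : HasDerivAt (fun a => c₀ + c₁ * a + c₂ * a ^ 2 + a ^ 3 * r a)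
      (c₁ + 2 * c₂ * a + a ^ 2 * (3 * r a + a * deriv r a)) a := by
    refine (((((hasDerivAt_id' a).const_mul c₁).const_add c₀).add
      (((hasDerivAt_id' a).pow 2).const_mul c₂)).add
      (((hasDerivAt_id' a).pow 3).mul hra.differentiableAt.hasDerivAt)).congr_deriv ?_
    simp only [Pi.pow_apply]
    push_cast
    ring
  exact (EventuallyEq.deriv_eq ha).trans h2.deriv

theorem deriv_eq (hg : HasJet g c₀ c₁ c₂) : deriv g 0 = c₁ := by
  obtain ⟨r, -, h1⟩ := hg.eventually_deriv
  simpa using h1.self_of_nhds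

theorem iteratedDeriv_two_eq (hg : HasJet g c₀ c₁ c₂) : iteratedDeriv 2 g 0 = 2 * c₂ := by
  obtain ⟨r, hr, h1⟩ := hg.eventually_deriv
  rw [iteratedDeriv_succ, iteratedDeriv_one, EventuallyEq.deriv_eq h1]
  have h2 : HasDerivAt (fun a => c₁ + 2 * c₂ * a + a ^ 2 * r a) (2 * c₂) 0 := by
    refine ((((hasDerivAt_id' (0 : ℂ)).const_mul (2 * c₂)).const_add c₁).add
      (((hasDerivAt_id' (0 : ℂ)).pow 2).mul hr.differentiableAt.hasDerivAt)).congr_deriv ?_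
    simp
  exact h2.deriv

/-- With `comp_mul` and `mul`, this turns functional equations into equations between Taylor
coefficients. -/
theorem unique (hg : HasJet g c₀ c₁ c₂) (hg' : HasJet g d₀ d₁ d₂) :
    c₀ = d₀ ∧ c₁ = d₁ ∧ c₂ = d₂ := by
  refine ⟨hg.apply_zero.symm.trans hg'.apply_zero, hg.deriv_eq.symm.trans hg'.deriv_eq, ?_⟩
  exact mul_left_cancel₀ two_ne_zero
    (hg.iteratedDeriv_two_eq.symm.trans hg'.iteratedDeriv_two_eq)

end HasJet

/-- The quotient `sin (π a) / a`, with its removable singularity removed. -/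
noncomputable def sinQuot : ℂ → ℂ := dslope (fun a : ℂ => Complex.sin (Real.pi * a)) 0

theorem mul_sinQuot (a : ℂ) : a * sinQuot a = Complex.sin (Real.pi * a) := by
  rw [sinQuot]
  simpa using sub_smul_dslope (fun a : ℂ => Complex.sin (Real.pi * a)) 0 a

theorem sinQuot_zero : sinQuot 0 = Real.pi := by
  have h : HasDerivAt (fun a : ℂ => Complex.sin (Real.pi * a))
      (Complex.cos (Real.pi * 0) * (Real.pi * 1)) 0 :=
    (Complex.hasDerivAt_sin _).comp (0 : ℂ) ((hasDerivAt_id _).const_mul _)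
  rw [sinQuot, dslope_same, h.deriv]
  simp

theorem analyticAt_sinQuot : AnalyticAt ℂ sinQuot 0 := by
  have : AnalyticAt ℂ (fun a : ℂ => Complex.sin (Real.pi * a)) 0 := by fun_prop
  obtain ⟨p, hp⟩ := this
  exact hp.has_fpower_series_dslope_fslope.analyticAt

/-- Evenness of the cosine, `sin² + cos² = 1` and the duplication of the sine determine the
coefficients in turn. -/
theorem hasJet_sinQuot_cos :
    HasJet sinQuot Real.pi 0 (-Real.pi ^ 3 / 6) ∧
      HasJet (fun a => Complex.cos (Real.pi * a)) 1 0 (-Real.pi ^ 2 / 2) := by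
  have hpi : (Real.pi : ℂ) ≠ 0 := by exact_mod_cast Real.pi_ne_zero
  obtain ⟨s₁, s₂, hs⟩ := exists_hasJet analyticAt_sinQuot
  rw [sinQuot_zero] at hs
  have hcosan : AnalyticAt ℂ (fun a : ℂ => Complex.cos (Real.pi * a)) 0 := by fun_prop
  obtain ⟨k₁, k₂, hk⟩ := exists_hasJet hcosan
  have hc0 : Complex.cos (Real.pi * 0) = 1 := by simp
  rw [hc0] at hk
  have hk1 : k₁ = 0 := by
    have h := ((hk.comp_mul (-1)).congr (h := fun a => Complex.cos (Real.pi * a))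
      (Eventually.of_forall fun a => by simp)).unique hk
    linear_combination (-1 / 2 : ℂ) * h.2.1
  subst hk1
  have hk2 : k₂ = -Real.pi ^ 2 / 2 := by
    have h := ((hk.mul hk).add ((HasJet.id.mul hs).mul (HasJet.id.mul hs))).congr
      (h := fun _ => 1) (Eventually.of_forall fun a => by
        rw [mul_sinQuot]
        linear_combination Complex.sin_sq_add_cos_sq (Real.pi * a))
    have := (h.unique (HasJet.const 1)).2.2
    linear_combination this / 2
  subst hk2
  have h := (hs.comp_mul 2).congr (h := fun a => sinQuot a * Complex.cos (Real.pi * a))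
    (Eventually.of_forall fun a => by
      by_cases ha : a = 0
      · simp [ha]
      · have h1 := mul_sinQuot (2 * a)
        rw [show (Real.pi : ℂ) * (2 * a) = 2 * (Real.pi * a) by ring, Complex.sin_two_mul,
          ← mul_sinQuot a] at h1
        refine mul_left_cancel₀ (mul_ne_zero two_ne_zero ha) ?_
        linear_combination h1)
  obtain ⟨-, h1, h2⟩ := h.unique (hs.mul hk)
  have hs1 : s₁ = 0 := by linear_combination h1
  have hs2 : s₂ = -Real.pi ^ 3 / 6 := by linear_combination h2 / 3
  rw [hs1, hs2] at hs
  exact ⟨hs, hk⟩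

theorem hasJet_exp (L : ℂ) : HasJet (fun a => Complex.exp (L * a)) 1 L (L ^ 2 / 2) := by
  have han : AnalyticAt ℂ (fun a => Complex.exp (L * a)) 0 := by fun_prop
  obtain ⟨p₁, p₂, hp⟩ := exists_hasJet han
  have h0 : Complex.exp (L * 0) = 1 := by simp
  rw [h0] at hp
  have h : HasDerivAt (fun a => Complex.exp (L * a)) (Complex.exp (L * 0) * (L * 1)) 0 :=
    (Complex.hasDerivAt_exp _).comp (0 : ℂ) ((hasDerivAt_id _).const_mul _)
  have hp1 : p₁ = L := by
    rw [← hp.deriv_eq, h.deriv]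
    simp
  have h2 := ((hp.comp_mul 2).congr (h := fun a => Complex.exp (L * a) * Complex.exp (L * a))
    (Eventually.of_forall fun a => by
      rw [← Complex.exp_add]
      ring_nf)).unique (hp.mul hp)
  subst hp1
  have hp2 : p₂ = p₁ ^ 2 / 2 := by linear_combination h2.2.2 / 2
  rwa [hp2] at hp

theorem analyticAt_Gamma_add_one : AnalyticAt ℂ (fun a => Complex.Gamma (a + 1)) 0 := by
  have hopen : IsOpen {a : ℂ | -1 < a.re} := isOpen_lt continuous_const Complex.continuous_re
  refine DifferentiableOn.analyticAt (s := {a : ℂ | -1 < a.re}) (fun a ha => ?_)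
    (hopen.mem_nhds (by simp))
  have ha : -1 < a.re := ha
  refine DifferentiableAt.differentiableWithinAt (DifferentiableAt.comp (g := Complex.Gamma) a
    (Complex.differentiableAt_Gamma _ fun m h => ?_) (by fun_prop))
  have h1 := congrArg Complex.re h
  simp at h1
  linarith [m.cast_nonneg (α := ℝ)]

/-- The relation is the second coefficient of `Γ(1 + a) Γ(1 - a) sinQuot a = π`. The value of `g₁`
is not needed, since it cancels in the application. -/
theorem exists_hasJet_Gamma : ∃ g₁ g₂ : ℂ, 2 * g₂ - g₁ ^ 2 = Real.pi ^ 2 / 6 ∧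
    HasJet (fun a => Complex.Gamma (a + 1)) 1 g₁ g₂ := by
  have hpi : (Real.pi : ℂ) ≠ 0 := by exact_mod_cast Real.pi_ne_zero
  obtain ⟨g₁, g₂, hg⟩ := exists_hasJet analyticAt_Gamma_add_one
  rw [zero_add, Complex.Gamma_one] at hg
  refine ⟨g₁, g₂, ?_, hg⟩
  have hsin : ∀ᶠ a : ℂ in 𝓝 0, sinQuot a ≠ 0 :=
    analyticAt_sinQuot.continuousAt.eventually_ne (by rwa [sinQuot_zero])
  have h := ((hg.mul (hg.comp_mul (-1))).mul hasJet_sinQuot_cos.1).congr (h := fun _ => (Real.pi : ℂ))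
    (by
      filter_upwards [hsin] with a ha
      by_cases h0 : a = 0
      · simp [h0, sinQuot_zero]
      · have h1 := Complex.Gamma_mul_Gamma_one_sub a
        rw [← mul_sinQuot, eq_div_iff (mul_ne_zero h0 ha)] at h1
        rw [Complex.Gamma_add_one a h0, show -1 * a + 1 = 1 - a by ring]
        linear_combination h1)
  have h2 := (h.unique (HasJet.const _)).2.2
  refine mul_left_cancel₀ hpi ?_
  linear_combination h2

theorem hasJet_second : HasJet second 0 0 (-4 * (Real.sqrt 2 * Real.pi)) := by
  have h0 : (0 : ℂ) ∈ strip := by constructor <;> norm_num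
  have han : AnalyticAt ℂ (fun a : ℂ => 16 / (2 * a - 1) * ∑' n, secondTerm a n) 0 := by
    refine AnalyticAt.mul (AnalyticAt.div (by fun_prop) (by fun_prop) (by norm_num)) ?_
    exact differentiableOn_tsum_secondTerm.analyticAt (isOpen_strip.mem_nhds h0)
  obtain ⟨c₁, c₂, hc⟩ := exists_hasJet han
  rw [tsum_secondTerm_zero] at hc
  have h := ((HasJet.id.mul HasJet.id).mul hc).congr (h := second) (Eventually.of_forall fun a => by
    rw [second]
    ring)
  convert h using 1 <;> ring

/-- Legendre duplication replaces `Γ(a + 1/2)` by `Γ(2 a + 1)`; the powers of two collect to `2 ^ (9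
a)`. The denominators are multiplied out so that only products of jets are needed. -/
theorem explicitTerm_eq_exp {a : ℂ} (h1 : Complex.Gamma (a + 1 / 2) ≠ 0)
    (h3 : Complex.cos (Real.pi * a) ≠ 0) :
    explicitTerm a * (Complex.Gamma (2 * a + 1) ^ 3 * Complex.cos (Real.pi * a)) =
      2 * Real.sqrt 2 / Real.pi * Complex.exp (9 * (Real.log 2 : ℂ) * a) *
        Complex.Gamma (a + 1) ^ 6 := by
  have hlog2 : Complex.log 2 = (Real.log 2 : ℂ) := by
    rw [Complex.ofReal_log zero_le_two]
    norm_num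
  have hlog8 : Complex.log 8 = 3 * (Real.log 2 : ℂ) := by
    have : Real.log 8 = 3 * Real.log 2 := by
      rw [show (8 : ℝ) = 2 ^ 3 by norm_num, Real.log_pow]
      norm_num
    have h : Complex.log 8 = (Real.log 8 : ℂ) := by
      rw [Complex.ofReal_log (by norm_num)]
      norm_num
    rw [h, this]
    push_cast
    rfl
  have hdup := Complex.Gamma_mul_Gamma_add_half (a + 1 / 2)
  rw [show a + 1 / 2 + 1 / 2 = a + 1 by ring, show 2 * (a + 1 / 2) = 2 * a + 1 by ring,
    show 1 - (2 * a + 1) = -(2 * a) by ring] at hdup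
  have hG : Complex.Gamma (1 / 2) = (Real.sqrt Real.pi : ℂ) := by
    rw [show (1 / 2 : ℂ) = ((1 / 2 : ℝ) : ℂ) by push_cast; rfl, Complex.Gamma_ofReal,
      Real.Gamma_one_half_eq]
  have h4 : (2 : ℂ) ^ (2 * a) * (2 : ℂ) ^ (-(2 * a)) = 1 := by
    rw [← Complex.cpow_add _ _ two_ne_zero, add_neg_cancel, Complex.cpow_zero]
  have h5 : Complex.Gamma (1 / 2) / gammaRatio a * Complex.Gamma (2 * a + 1) =
      (2 : ℂ) ^ (2 * a) * Complex.Gamma (a + 1) ^ 2 := by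
    rw [gammaRatio, div_div_eq_mul_div, div_mul_eq_mul_div, div_eq_iff h1, hG]
    linear_combination (-(2 : ℂ) ^ (2 * a) * Complex.Gamma (a + 1)) * hdup -
      (Complex.Gamma (2 * a + 1) * Complex.Gamma (a + 1) * (Real.sqrt Real.pi : ℂ)) * h4
  have h6 : (8 : ℂ) ^ a * ((2 : ℂ) ^ (2 * a)) ^ 3 = Complex.exp (9 * (Real.log 2 : ℂ) * a) := by
    rw [Complex.cpow_def_of_ne_zero (by norm_num), Complex.cpow_def_of_ne_zero two_ne_zero, hlog2,
      hlog8, ← Complex.exp_nat_mul, ← Complex.exp_add]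
    congr 1
    push_cast
    ring
  rw [explicitTerm_eq, ← h6]
  calc _ = 2 * Real.sqrt 2 / Real.pi * (8 : ℂ) ^ a *
        (Complex.Gamma (1 / 2) / gammaRatio a * Complex.Gamma (2 * a + 1)) ^ 3 *
        (Complex.cos (Real.pi * a) / Complex.cos (Real.pi * a)) := by ring
    _ = _ := by
      rw [h5, div_self h3]
      ring

theorem hasJet_f : HasJet f (2 * Real.sqrt 2 / Real.pi)
    (2 * Real.sqrt 2 / Real.pi * (9 * Real.log 2))
    (2 * Real.sqrt 2 / Real.pi * ((9 * Real.log 2) ^ 2 / 2) - 4 * (Real.sqrt 2 * Real.pi)) := by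
  obtain ⟨f₁, f₂, hf⟩ := exists_hasJet analyticAt_f
  rw [f_zero] at hf
  obtain ⟨g₁, g₂, hrel, hg⟩ := exists_hasJet_Gamma
  have hcos := hasJet_sinQuot_cos.2
  have hg2 := hg.comp_mul 2
  set c : ℂ := 2 * Real.sqrt 2 / Real.pi with hc
  have hleft := (hf.add ((HasJet.const (-1)).mul hasJet_second)).mul
    ((hg2.mul (hg2.mul hg2)).mul hcos)
  have hg3 := hg.mul (hg.mul hg)
  have hright := ((HasJet.const c).mul (hasJet_exp (9 * (Real.log 2 : ℂ)))).mul (hg3.mul hg3)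
  have hmem : ∀ᶠ a : ℂ in 𝓝 0, a ∈ {a : ℂ | -(1 / 4) < a.re ∧ a.re < 1 / 4} :=
    ((isOpen_lt continuous_const Complex.continuous_re).inter
      (isOpen_lt Complex.continuous_re continuous_const)).mem_nhds (by constructor <;> norm_num)
  have heq := hleft.congr (h := fun a => c * Complex.exp (9 * (Real.log 2 : ℂ) * a) *
    (Complex.Gamma (a + 1) * (Complex.Gamma (a + 1) * Complex.Gamma (a + 1)) *
      (Complex.Gamma (a + 1) * (Complex.Gamma (a + 1) * Complex.Gamma (a + 1))))) (by
    filter_upwards [hmem] with a ha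
    obtain ⟨ha1, ha2⟩ := ha
    have hN := notHalfInteger_of_mem_strip (a := a) ⟨ha1, by linarith⟩ (by
      rintro rfl
      norm_num at ha2)
    have h1 : Complex.Gamma (a + 1 / 2) ≠ 0 :=
      Complex.Gamma_ne_zero_of_re_pos (by simp; linarith)
    have h3 := explicitTerm_eq_exp h1 (notHalfInteger_iff.1 hN)
    rw [f_eq_second (admissible_of_re (by linarith)) hN]
    linear_combination h3)
  obtain ⟨-, e1, e2⟩ := heq.unique hright
  have hf1 : f₁ = c * (9 * Real.log 2) := by linear_combination e1
  subst hf1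
  have hf2 : f₂ = c * ((9 * Real.log 2) ^ 2 / 2) - 4 * (Real.sqrt 2 * Real.pi) := by
    -- The second-order contributions of `Γ(a + 1) ^ 6 / Γ(2 a + 1) ^ 3` and of `1 / cos (π a)`
    -- cancel, leaving the exponential and `second`.
    linear_combination e2 - 3 * c * hrel
  rwa [hf2] at hf

end ExtendedRamanujan

theorem mainTheorem3 :
    -- the series `f(a)` converges for every `a` that is not a negative integer
    (∀ a : ℂ, ExtendedRamanujan.Admissible a → Summable (ExtendedRamanujan.fTerm a)) ∧
    -- the first identity, for all `a` for which its series converges; this includes `0 < re a`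
    (∀ a : ℂ, 0 < a.re → Summable (ExtendedRamanujan.firstTerm a)) ∧
    (∀ a : ℂ, ExtendedRamanujan.Admissible a → Summable (ExtendedRamanujan.firstTerm a) →
      ExtendedRamanujan.f a = 4 * a * ∑' n : ℕ, ExtendedRamanujan.firstTerm a n) ∧
    -- the second identity, for all `a` for which its right-hand side is defined
    (∀ a : ℂ, ExtendedRamanujan.Admissible a → Complex.cos (Real.pi * a) ≠ 0 →
      Summable (ExtendedRamanujan.secondTerm a) ∧
      ExtendedRamanujan.f a =
        2 * (Real.sqrt 2 : ℂ) / Real.pi * ((8 : ℂ) ^ a / Complex.cos (Real.pi * a))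
            * (ExtendedRamanujan.cpoch 1 a ^ 3 / ExtendedRamanujan.cpoch (1 / 2) a ^ 3)
          + 16 * a ^ 2 / (2 * a - 1) * ∑' n : ℕ, ExtendedRamanujan.secondTerm a n) ∧
    -- the special values
    ExtendedRamanujan.f (1 / 2) = 4 * (ExtendedRamanujan.catalanConstant : ℂ) ∧
    ExtendedRamanujan.f 0 = 2 * (Real.sqrt 2 : ℂ) / Real.pi ∧
    AnalyticAt ℂ ExtendedRamanujan.f 0 ∧
    deriv ExtendedRamanujan.f 0 = 18 * (Real.sqrt 2 : ℂ) / Real.pi * (Real.log 2 : ℂ) ∧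
    iteratedDeriv 2 ExtendedRamanujan.f 0 =
      2 * (Real.sqrt 2 : ℂ) / Real.pi
        * (81 * (Real.log 2 : ℂ) ^ 2 - 4 * (Real.pi : ℂ) ^ 2) := by
  open ExtendedRamanujan in
  refine ⟨fun a _ => summable_fTerm a, fun a => summable_firstTerm, fun a => f_eq_first,
    fun a ha hcos => ⟨summable_secondTerm a, f_eq_second ha (notHalfInteger_iff.2 hcos)⟩,
    f_half, f_zero, analyticAt_f, ?_, ?_⟩
  · rw [hasJet_f.deriv_eq]
    ring
  · have hpi : (Real.pi : ℂ) ≠ 0 := by exact_mod_cast Real.pi_ne_zero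
    rw [hasJet_f.iteratedDeriv_two_eq]
    field_simp
    ring
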